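/- **Setting.** Let $\mu\in\mathbb R$, $\sigma^2>0$, $N_0>0$, let $c_0,c_1,c_e\ge 0$ and $\alpha>0$. Complex random pilots $p[1],p[2],\dots$ have an arbitrary law, the same under two hypotheses, and real observations $y[1],y[2],\dots$ satisfy $$\mathsf H_0:\ y[t]=w[t],\qquad \mathsf H_1:\ y[t]=x\,|p[t]|^2+w[t].$$ Given the pilots, the noises $w[t]$ are independent with $w[t]\sim\mathcal N(0,|p[t]|^2N_0/2)$; under $\mathsf H_1$ the channel coefficient $x\sim\mathcal N(\mu/2,\sigma^2/2)$ is independent of pilots and noise. Write $\mathsf P_0,\mathsf P_1$ for the probability measures under $\mathsf H_0,\mathsf H_1$ ($x$ being random under $\mathsf P_1$), $\mathcal F_t=\sigma(p[1],\dots,p[t])$ and $\mathcal G_t=\sigma((y[1],p[1]),\dots,(y[t],p[t]))$. A rule is a triplet $(\tau,d,\hat x)$ in which $\tau\in\{1,2,\dots\}\cup\{\infty\}$ is an $(\mathcal F_t)$-stopping time and $d\in\{0,1\}$, $\hat x\in\mathbb R$ are $\mathcal G_\tau$-measurable. Its cost is $$\mathcal C(\tau,d,\hat x)=c_0\mathsf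 P_0(d=1\mid\mathcal F_\tau)+c_1\mathsf P_1(d=0\mid\mathcal F_\tau)+c_e\mathsf E_1\big[(\hat x-x)^2\mathbf 1_{\{d=1\}}+x^2\mathbf 1_{\{d=0\}}\mid\mathcal F_\tau\big]\in[0,\infty],$$ and it is feasible if $\mathcal C(\tau,d,\hat x)\le\alpha$ almost surely on $\{\tau<\infty\}$. The problem is to minimize $\tau$ over all feasible rules. Put $U_t=\sum_{m=1}^t|p[m]|^2$, $V_t=\sum_{m=1}^t y[m]$ and $$\hat x_t=\frac{V_t+\frac{\mu}{2}\frac{N_0}{\sigma^2}}{U_t+\frac{N_0}{\sigma^2}},\qquad L_t=\frac{\big(V_t+\frac{\mu}{2}\frac{N_0}{\sigma^2}\big)^2}{N_0\big(U_t+\frac{N_0}{\sigma^2}\big)}-\frac{\mu^2}{4\sigma^2}-\frac12\log\Big(\frac{\sigma^2}{N_0}U_t+1\Big),$$ and let $d_t=1$ if $L_t\ge\log\frac{c_0}{c_1+c_e\hat x_t^2}$ and $d_t=0$ otherwise (with $\log 0=-\infty$, $\log\frac c0=+\infty$ for $c>0$, and $\log\frac00=-\infty$). **Theorem.** There is a constant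 $\gamma\in\mathbb R$, depending only on $\mu,\sigma^2,N_0,c_0,c_1,c_e,\alpha$ (not on the law of the pilots), such that with $\tau^*=\min\{t>0:U_t\ge\gamma\}$ (and $\tau^*=\infty$ if there is no such $t$) the triplet $(\tau^*,d_{\tau^*},\hat x_{\tau^*})$ is optimal: 1. $(\tau^*,d_{\tau^*},\hat x_{\tau^*})$ is feasible, and every feasible $(\tau,d,\hat x)$ satisfies $\tau^*\le\tau$ almost surely. 2. For every rule $(\tau,d,\hat x)$, $(\tau,d_\tau,\hat x_\tau)$ is a rule and $\mathcal C(\tau,d_\tau,\hat x_\tau)\le\mathcal C(\tau,d,\hat x)$ almost surely on $\{\tau<\infty\}$. 3. If $U_t\to\infty$ almost surely, then $\tau^*<\infty$ almost surely. Moreover, for all $t$: $\hat x_t=\mathsf E_1[x\mid\mathcal G_t]$ almost surely, i.e. $\hat x_t$ is the MMSE estimator; $L_t$ is the conditional log-likelihood ratio of $\mathsf H_1$ against $\mathsf H_0$ given $\mathcal F_t$ with $x$ marginalized, i.e. $\mathsf P_1(A\mid\mathcal F_t)=\mathsf E_0[e^{L_t}\mathbf 1_A\mid\mathcal F_t]$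 almost surely for every $A\in\mathcal G_t$; and $\frac{2}{N_0}U_t$ is the conditional Fisher information, given the pilots $p[1],\dots,p[t]$, about $x$ in $y[1],\dots,y[t]$ under $\mathsf H_1$. -/

import Mathlib

open MeasureTheory ProbabilityTheory
open scoped NNReal ENNReal

namespace SJDE

section Model

variable {Ω : Type*} [mΩ : MeasurableSpace Ω]

/-! Time convention: the samples are taken at times `1, 2, 3, …`; the pilot and the observation of
time `m + 1` are `p m` and `y m`, so that "up to time `t`" means `m < t`. -/

/-- The additive noise `w[m]` under the hypothesis that the signal is present:
the observation minus `x |p[m]|²`. -/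
noncomputable def noise (p : ℕ → Ω → ℂ) (y : ℕ → Ω → ℝ) (x : Ω → ℝ) (m : ℕ) (ω : Ω) : ℝ :=
  y m ω - x ω * ‖p m ω‖ ^ 2

/-- Law of the noise sequence given the pilot path `q`: independent over time, the noise at the
pilot `q m` being centred Gaussian with variance `|q m|² N₀ / 2`. -/
noncomputable def noiseLaw (N₀ : ℝ≥0) (q : ℕ → ℂ) : Measure (ℕ → ℝ) :=
  Measure.infinitePi fun m => gaussianReal 0 (‖q m‖₊ ^ 2 * (N₀ / 2))

/-- The real single-channel model. `P₀` and `P₁` are the probability measures under the hypotheses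
`H₀` (only noise is observed) and `H₁` (`y = x |p|² + noise`, with `x ∼ N(μ/2, σ²/2)`).
The law of the pilots is arbitrary and does not depend on the hypothesis. -/
structure IsChannelModel (μ : ℝ) (σ2 N₀ : ℝ≥0) (P₀ P₁ : Measure Ω) [IsProbabilityMeasure P₀]
    [IsProbabilityMeasure P₁] (p : ℕ → Ω → ℂ) (y : ℕ → Ω → ℝ) (x : Ω → ℝ) : Prop where
  measurable_pilot : ∀ m, Measurable (p m)
  measurable_obs : ∀ m, Measurable (y m)
  measurable_channel : Measurable x
  /-- the pilots have the same law under both hypotheses -/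
  pilot_law : P₀.map (fun ω m => p m ω) = P₁.map (fun ω m => p m ω)
  /-- under `H₀`, given the pilots, the observations are pure noise -/
  obs_H0 : ∀ᵐ q ∂(P₀.map fun ω m => p m ω),
    condDistrib (fun ω m => y m ω) (fun ω m => p m ω) P₀ q = noiseLaw N₀ q
  /-- under `H₁`, the channel coefficient is Gaussian -/
  channel_law : P₁.map x = gaussianReal (μ / 2) (σ2 / 2)
  /-- under `H₁`, given the pilots, `y - x |p|²` is noise -/
  noise_H1 : ∀ᵐ q ∂(P₁.map fun ω m => p m ω),
    condDistrib (fun ω m => noise p y x m ω) (fun ω m => p m ω) P₁ q = noiseLaw N₀ q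
  /-- under `H₁`, the channel coefficient is independent of pilots and noise -/
  indep : IndepFun x (fun ω => ((fun m => p m ω), (fun m => noise p y x m ω))) P₁

/-- The pilot history `ℱ_t = σ(p[1], …, p[t])`. -/
noncomputable def pilotHistory (p : ℕ → Ω → ℂ) (hp : ∀ m, Measurable (p m)) : Filtration ℕ mΩ where
  seq t := ⨆ m, ⨆ _ : m < t, MeasurableSpace.comap (p m) inferInstance
  mono' _ _ hst := iSup_mono fun _ => iSup_le fun h =>
    le_iSup_of_le (lt_of_lt_of_le h hst) le_rfl
  le' _ := iSup_le fun m => iSup_le fun _ => (hp m).comap_le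

/-- The complete observation history `𝒢_t = σ((y[1], p[1]), …, (y[t], p[t]))`. -/
noncomputable def obsHistory (p : ℕ → Ω → ℂ) (y : ℕ → Ω → ℝ) (hp : ∀ m, Measurable (p m))
    (hy : ∀ m, Measurable (y m)) : Filtration ℕ mΩ where
  seq t := ⨆ m, ⨆ _ : m < t, MeasurableSpace.comap (fun ω => (y m ω, p m ω)) inferInstance
  mono' _ _ hst := iSup_mono fun _ => iSup_le fun h =>
    le_iSup_of_le (lt_of_lt_of_le h hst) le_rfl
  le' _ := iSup_le fun m => iSup_le fun _ => ((hy m).prodMk (hp m)).comap_le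

theorem pilotHistory_le_obsHistory (p : ℕ → Ω → ℂ) (y : ℕ → Ω → ℝ) (hp : ∀ m, Measurable (p m))
    (hy : ∀ m, Measurable (y m)) (t : ℕ) : pilotHistory p hp t ≤ obsHistory p y hp hy t := by
  refine iSup_mono fun m => iSup_mono fun _ => ?_
  have h : p m = Prod.snd ∘ fun ω => (y m ω, p m ω) := rfl
  rw [h, ← MeasurableSpace.comap_comp]
  exact MeasurableSpace.comap_mono measurable_snd.comap_le

/-- A stopping time of the pilot history is one of the complete observation history. -/
theorem isStoppingTime_obs {p : ℕ → Ω → ℂ} {y : ℕ → Ω → ℝ} {hp : ∀ m, Measurable (p m)}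
    {hy : ∀ m, Measurable (y m)} {τ : Ω → WithTop ℕ}
    (hτ : IsStoppingTime (pilotHistory p hp) τ) : IsStoppingTime (obsHistory p y hp hy) τ :=
  fun i => pilotHistory_le_obsHistory p y hp hy i _ (hτ i)

/-- The combined detection and estimation cost
`c₀ P₀(d = 1 | m) + c₁ P₁(d = 0 | m) + c_e E₁[(x̂ - x)² 1_{d = 1} + x² 1_{d = 0} | m]`
given the σ-algebra `m`, for the decision `d` (`1` meaning `H₁`) and the estimate `xhat`.
It takes values in `[0, ∞]`, so that no integrability is needed. -/
noncomputable def cost (c₀ c₁ ce : ℝ≥0) (P₀ P₁ : Measure Ω) (x : Ω → ℝ) (m : MeasurableSpace Ω)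
    (d : Ω → Fin 2) (xhat : Ω → ℝ) (ω : Ω) : ℝ≥0∞ :=
  c₀ * condLExp m P₀ ({ω' | d ω' = 1}.indicator 1) ω
    + c₁ * condLExp m P₁ ({ω' | d ω' = 0}.indicator 1) ω
    + ce * condLExp m P₁ (fun ω' =>
        {ω' | d ω' = 1}.indicator (fun ω' => ENNReal.ofReal ((xhat ω' - x ω') ^ 2)) ω'
        + {ω' | d ω' = 0}.indicator (fun ω' => ENNReal.ofReal (x ω' ^ 2)) ω') ω

/-- Sequential rules: `τ` is a stopping time of the pilot history that takes at least one sample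
(and may be infinite), `d` and `xhat` are measurable for the observations up to time `τ`. -/
structure IsRule (p : ℕ → Ω → ℂ) (y : ℕ → Ω → ℝ) (hp : ∀ m, Measurable (p m))
    (hy : ∀ m, Measurable (y m)) (τ : Ω → WithTop ℕ) (d : Ω → Fin 2) (xhat : Ω → ℝ) : Prop where
  isStopping : IsStoppingTime (pilotHistory p hp) τ
  pos : ∀ ω, 1 ≤ τ ω
  decision : Measurable[(isStoppingTime_obs (hy := hy) isStopping).measurableSpace] d
  estimate : Measurable[(isStoppingTime_obs (hy := hy) isStopping).measurableSpace] xhat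

/-- Feasible rules: whenever the rule stops, the cost conditioned on the pilot history up to
the stopping time is at most `α`. The pilots have the same law under both hypotheses,
so "almost surely" means the same under `P₀` and under `P₁`. -/
structure IsFeasible (c₀ c₁ ce α : ℝ≥0) (P₀ P₁ : Measure Ω) (p : ℕ → Ω → ℂ) (y : ℕ → Ω → ℝ)
    (x : Ω → ℝ) (hp : ∀ m, Measurable (p m)) (hy : ∀ m, Measurable (y m))
    (τ : Ω → WithTop ℕ) (d : Ω → Fin 2) (xhat : Ω → ℝ) : Prop
    extends IsRule p y hp hy τ d xhat where
  cost_le : ∀ᵐ ω ∂(P₀ + P₁), τ ω ≠ ⊤ →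
    cost c₀ c₁ ce P₀ P₁ x isStopping.measurableSpace d xhat ω ≤ α

/-- `U_t = ∑_{m ≤ t} |p[m]|²`. -/
noncomputable def U (p : ℕ → Ω → ℂ) (t : ℕ) (ω : Ω) : ℝ := ∑ m ∈ Finset.range t, ‖p m ω‖ ^ 2

/-- `V_t = ∑_{m ≤ t} y[m]`. -/
noncomputable def V (y : ℕ → Ω → ℝ) (t : ℕ) (ω : Ω) : ℝ := ∑ m ∈ Finset.range t, y m ω

/-- The estimator `x̂_t`. -/
noncomputable def estimator (μ : ℝ) (σ2 N₀ : ℝ≥0) (p : ℕ → Ω → ℂ) (y : ℕ → Ω → ℝ)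
    (t : ℕ) (ω : Ω) : ℝ :=
  (V y t ω + μ / 2 * (N₀ / σ2)) / (U p t ω + N₀ / σ2)

/-- The log-likelihood ratio statistic `L_t`. -/
noncomputable def llr (μ : ℝ) (σ2 N₀ : ℝ≥0) (p : ℕ → Ω → ℂ) (y : ℕ → Ω → ℝ)
    (t : ℕ) (ω : Ω) : ℝ :=
  (V y t ω + μ / 2 * (N₀ / σ2)) ^ 2 / (N₀ * (U p t ω + N₀ / σ2)) - μ ^ 2 / (4 * σ2)
    - 1 / 2 * Real.log (σ2 / N₀ * U p t ω + 1)

/-- The modified likelihood ratio test: `d_t = 1` iff `L_t ≥ log (c₀ / (c₁ + c_e x̂_t²))`.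
The threshold is an extended real, with `log 0 = -∞`, `log (c / 0) = +∞` for `c > 0`,
and `log (0 / 0) = -∞`. -/
noncomputable def decision (μ : ℝ) (σ2 N₀ c₀ c₁ ce : ℝ≥0) (p : ℕ → Ω → ℂ) (y : ℕ → Ω → ℝ)
    (t : ℕ) (ω : Ω) : Fin 2 :=
  open Classical in
  if ENNReal.log (c₀ / (c₁ + ce * ENNReal.ofReal (estimator μ σ2 N₀ p y t ω ^ 2)))
      ≤ ((llr μ σ2 N₀ p y t ω : ℝ) : EReal) then 1 else 0

/-- The stopping time `min {t > 0 : U_t ≥ γ}` (`⊤` if there is no such `t`). -/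
noncomputable def stopAt (p : ℕ → Ω → ℂ) (γ : ℝ) : Ω → WithTop ℕ :=
  hittingAfter (U p) (Set.Ici γ) 1

end Model

/-- Given the pilots `q 0, …, q (t - 1)`, the log-density of the observations `z` when the channel
coefficient is `s`. A vanishing pilot contributes the constant `0`: it gives an observation `0`,
whatever `s` is. -/
noncomputable def logDensity (N₀ : ℝ≥0) (q : ℕ → ℂ) (t : ℕ) (z : Fin t → ℝ) (s : ℝ) : ℝ :=
  ∑ m : Fin t, Real.log (gaussianPDFReal (s * ‖q m‖ ^ 2) (‖q m‖₊ ^ 2 * (N₀ / 2)) (z m))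

/-- Fisher information about the channel coefficient, at the value `s`, in the observations up to
time `t`, given the pilots `q`: the second moment of the score. -/
noncomputable def condFisherInfo (N₀ : ℝ≥0) (q : ℕ → ℂ) (t : ℕ) (s : ℝ) : ℝ :=
  ∫ z, deriv (logDensity N₀ q t z) s ^ 2
    ∂(Measure.pi fun m : Fin t => gaussianReal (s * ‖q m‖ ^ 2) (‖q m‖₊ ^ 2 * (N₀ / 2)))

end SJDE

/-! Given the pilots, the data enter only through the pair (U, V). For a known channel value s, the
Cameron–Martin formula gives the likelihood ratio exp((2sV - s²U)/N₀) of signal plus noise against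
pure noise (`noiseLawUpTo_shift`). Multiplying by the Gaussian prior and completing the square in s
factors this into exp L times a Gaussian posterior density, with mean x̂ and a variance that depends
on U alone (`condLikRatio_mul_gaussianPDF`). Every expectation under H₁ of pilots, observations and
channel thus becomes an expectation under H₀ (`lintegral_alt_eq_null`).

On the event τ = t the conditional cost is therefore the H₀-expectation, given the pilots, of an
explicit function of U_t, V_t, the decision and the estimate (`setLIntegral_cost`). It is minimized
pointwise: the best estimate is the posterior mean, and the best decision compares c₀ with exp(L)(c₁
+ c_e x̂²). The stopping time sees the pilots only, so selecting τ = t does not disturb the null law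
N(0, U_t N₀/2) of V_t, and the minimum averages to a deterministic function `optCost` of U_t.

This function is nonincreasing (`optCost_anti`, by a martingale argument), continuous, and tends to
0 (`tendsto_optCost_atTop`). Hence it is at most α exactly on a half-line u ≥ γ, where γ does not
involve the law of the pilots (`exists_energy_threshold`). A feasible rule must have collected
energy γ when it stops, and the first time at which this happens is enough. -/

namespace SJDE

/-! ### Bayes' formula for the Gaussian channel coefficient -/

section GaussianPosterior

variable (μ : ℝ) (σ2 N₀ : ℝ≥0)

/-- Posterior mean of the channel coefficient as a function of `(U, V)`. -/
noncomputable def postMean (u v : ℝ) : ℝ := (v + μ / 2 * (N₀ / σ2)) / (u + N₀ / σ2)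

/-- Posterior variance of the channel coefficient as a function of `U`. -/
noncomputable def postVar (u : ℝ) : ℝ≥0 := (N₀ / 2 / (u + N₀ / σ2) : ℝ).toNNReal

/-- Log-likelihood ratio as a function of `(U, V)`. -/
noncomputable def logLR (u v : ℝ) : ℝ :=
  (v + μ / 2 * (N₀ / σ2)) ^ 2 / (N₀ * (u + N₀ / σ2)) - μ ^ 2 / (4 * σ2)
    - 1 / 2 * Real.log (σ2 / N₀ * u + 1)

/-- Likelihood ratio as a function of `(U, V)`. -/
noncomputable def likRatio (u v : ℝ) : ℝ≥0∞ := ENNReal.ofReal (Real.exp (logLR μ σ2 N₀ u v))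

/-- Likelihood ratio for a known channel coefficient `s` as a function of `(U, V)`. -/
noncomputable def condLikRatio (s u v : ℝ) : ℝ≥0∞ :=
  ENNReal.ofReal (Real.exp ((2 * s * v - s ^ 2 * u) / N₀))

lemma measurable_postMean : Measurable fun z : ℝ × ℝ => postMean μ σ2 N₀ z.1 z.2 := by
  unfold postMean; fun_prop

lemma measurable_postVar : Measurable (postVar σ2 N₀) := by
  unfold postVar; fun_prop

lemma measurable_logLR : Measurable fun z : ℝ × ℝ => logLR μ σ2 N₀ z.1 z.2 := by
  unfold logLR; fun_prop

lemma measurable_likRatio : Measurable fun z : ℝ × ℝ => likRatio μ σ2 N₀ z.1 z.2 := by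
  unfold likRatio
  exact (measurable_logLR μ σ2 N₀).exp.ennreal_ofReal

variable {μ σ2 N₀}

lemma likRatio_ne_top (u v : ℝ) : likRatio μ σ2 N₀ u v ≠ ∞ := ENNReal.ofReal_ne_top

lemma coe_postVar (hσ : 0 < σ2) (hN : 0 < N₀) {u : ℝ} (hu : 0 ≤ u) :
    (postVar σ2 N₀ u : ℝ) = N₀ / 2 / (u + N₀ / σ2) := by
  have : (0 : ℝ) < σ2 := hσ
  have : (0 : ℝ) < N₀ := hN
  exact Real.coe_toNNReal _ (by positivity)

lemma postVar_ne_zero (hσ : 0 < σ2) (hN : 0 < N₀) {u : ℝ} (hu : 0 ≤ u) : postVar σ2 N₀ u ≠ 0 := by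
  have h1 : (0 : ℝ) < σ2 := hσ
  have h2 : (0 : ℝ) < N₀ := hN
  have : (0 : ℝ) < postVar σ2 N₀ u := by rw [coe_postVar hσ hN hu]; positivity
  exact fun h => by simp [h] at this

lemma postVar_anti (hσ : 0 < σ2) (hN : 0 < N₀) {u u' : ℝ} (hu : 0 ≤ u) (h : u ≤ u') :
    postVar σ2 N₀ u' ≤ postVar σ2 N₀ u := by
  have h1 : (0 : ℝ) < σ2 := hσ
  have h2 : (0 : ℝ) < N₀ := hN
  exact Real.toNNReal_mono (by gcongr)

/-- Completing the square in s. The prior and posterior normalizing constants differ by the factor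
√(σ²U/N₀ + 1), which is the source of the logarithm in L. -/
lemma condLikRatio_mul_gaussianPDF (hσ : 0 < σ2) (hN : 0 < N₀) {u : ℝ} (hu : 0 ≤ u) (v s : ℝ) :
    condLikRatio N₀ s u v * gaussianPDF (μ / 2) (σ2 / 2) s =
      likRatio μ σ2 N₀ u v * gaussianPDF (postMean μ σ2 N₀ u v) (postVar σ2 N₀ u) s := by
  have h1 : (0 : ℝ) < σ2 := hσ
  have h2 : (0 : ℝ) < N₀ := hN
  have h3 : 0 < u + N₀ / σ2 := by positivity
  have h4 : 0 < σ2 / N₀ * u + 1 := by positivity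
  simp only [condLikRatio, likRatio, gaussianPDF]
  rw [← ENNReal.ofReal_mul (Real.exp_pos _).le, ← ENNReal.ofReal_mul (Real.exp_pos _).le]
  congr 1
  simp only [gaussianPDFReal]
  have hsqrt : Real.sqrt (2 * Real.pi * (σ2 / 2 : ℝ≥0)) =
      Real.sqrt (2 * Real.pi * postVar σ2 N₀ u) * Real.sqrt (σ2 / N₀ * u + 1) := by
    rw [← Real.sqrt_mul' _ h4.le, coe_postVar hσ hN hu]
    congr 1
    push_cast
    field_simp
  have hlog : Real.exp (-(1 / 2 * Real.log (σ2 / N₀ * u + 1))) =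
      (Real.sqrt (σ2 / N₀ * u + 1))⁻¹ := by
    rw [Real.exp_neg, Real.sqrt_eq_rpow, Real.rpow_def_of_pos h4, mul_comm (1 / 2 : ℝ)]
  rw [hsqrt, mul_inv]
  have hL : logLR μ σ2 N₀ u v = ((v + μ / 2 * (N₀ / σ2)) ^ 2 / (N₀ * (u + N₀ / σ2))
      - μ ^ 2 / (4 * σ2)) + -(1 / 2 * Real.log (σ2 / N₀ * u + 1)) := by
    rw [logLR]; ring
  rw [hL, Real.exp_add, hlog]
  have hexp : Real.exp ((2 * s * v - s ^ 2 * u) / N₀) *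
        Real.exp (-(s - μ / 2) ^ 2 / (2 * (σ2 / 2 : ℝ≥0))) =
      Real.exp ((v + μ / 2 * (N₀ / σ2)) ^ 2 / (N₀ * (u + N₀ / σ2)) - μ ^ 2 / (4 * σ2)) *
        Real.exp (-(s - postMean μ σ2 N₀ u v) ^ 2 / (2 * postVar σ2 N₀ u)) := by
    rw [← Real.exp_add, ← Real.exp_add, coe_postVar hσ hN hu, postMean]
    congr 1
    push_cast
    field_simp
    ring
  generalize (√(2 * Real.pi * (postVar σ2 N₀ u)))⁻¹ = A at *
  generalize (√(σ2 / N₀ * u + 1))⁻¹ = B at *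
  rw [mul_left_comm, hexp]
  ring

/-- Bayes' formula: reweighting the prior by the likelihood gives the posterior. -/
lemma lintegral_condLikRatio_mul (hσ : 0 < σ2) (hN : 0 < N₀) {u : ℝ} (hu : 0 ≤ u) (v : ℝ)
    {φ : ℝ → ℝ≥0∞} (hφ : Measurable φ) :
    ∫⁻ s, condLikRatio N₀ s u v * φ s ∂gaussianReal (μ / 2) (σ2 / 2) =
      likRatio μ σ2 N₀ u v *
        ∫⁻ s, φ s ∂gaussianReal (postMean μ σ2 N₀ u v) (postVar σ2 N₀ u) := by
  have hm : Measurable fun s => condLikRatio N₀ s u v := by unfold condLikRatio; fun_prop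
  rw [gaussianReal_of_var_ne_zero _ (by positivity : σ2 / 2 ≠ 0),
    gaussianReal_of_var_ne_zero _ (postVar_ne_zero hσ hN hu),
    lintegral_withDensity_eq_lintegral_mul _ (measurable_gaussianPDF _ _)
      (g := fun s => condLikRatio N₀ s u v * φ s)
      (hm.mul hφ),
    lintegral_withDensity_eq_lintegral_mul _ (measurable_gaussianPDF _ _) hφ,
    ← lintegral_const_mul _ ((measurable_gaussianPDF _ _).mul hφ)]
  refine lintegral_congr fun s => ?_
  have := condLikRatio_mul_gaussianPDF (μ := μ) hσ hN hu v s
  simp only [Pi.mul_apply]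
  rw [← mul_assoc, ← mul_assoc, mul_comm (gaussianPDF _ _ _), this]

/-- The likelihood ratio is the mixture of the likelihood ratios with known channel coefficient. -/
lemma likRatio_eq_lintegral (hσ : 0 < σ2) (hN : 0 < N₀) {u : ℝ} (hu : 0 ≤ u) (v : ℝ) :
    likRatio μ σ2 N₀ u v = ∫⁻ s, condLikRatio N₀ s u v ∂gaussianReal (μ / 2) (σ2 / 2) := by
  simpa using (lintegral_condLikRatio_mul (μ := μ) hσ hN hu v (φ := 1) measurable_one).symm

end GaussianPosterior

/-- Bias–variance decomposition: the square is expanded around the mean m. -/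
lemma lintegral_sq_sub_gaussianReal (a m : ℝ) (v : ℝ≥0) :
    ∫⁻ s, ENNReal.ofReal ((a - s) ^ 2) ∂gaussianReal m v = ENNReal.ofReal ((a - m) ^ 2) + v := by
  have hL : MemLp (fun s : ℝ => s) 2 (gaussianReal m v) := memLp_id_gaussianReal 2
  have hi : Integrable (fun s : ℝ => s) (gaussianReal m v) := hL.integrable (by norm_num)
  have hi2 : Integrable (fun s : ℝ => (s - m) ^ 2) (gaussianReal m v) :=
    (hL.sub (memLp_const m)).integrable_sq
  have hvar : ∫ s, (s - m) ^ 2 ∂gaussianReal m v = v := by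
    have := variance_fun_id_gaussianReal (μ := m) (v := v)
    rwa [variance_eq_integral measurable_id'.aemeasurable, integral_id_gaussianReal] at this
  have hexp : (fun s : ℝ => (a - s) ^ 2) =
      fun s => (s - m) ^ 2 + (2 * (m - a) * s + ((a - m) ^ 2 - 2 * (m - a) * m)) := by
    ext s; ring
  have hi3 : Integrable (fun s : ℝ => 2 * (m - a) * s + ((a - m) ^ 2 - 2 * (m - a) * m))
      (gaussianReal m v) := (hi.const_mul _).add (integrable_const _)
  rw [← ofReal_integral_eq_lintegral_ofReal (hexp ▸ hi2.add hi3)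
    (Filter.Eventually.of_forall fun s => sq_nonneg _), hexp, integral_add hi2 hi3,
    integral_add (hi.const_mul _) (integrable_const _), integral_const_mul,
    integral_id_gaussianReal, hvar, integral_const]
  simp only [probReal_univ, one_smul]
  rw [show (v : ℝ) + (2 * (m - a) * m + ((a - m) ^ 2 - 2 * (m - a) * m)) = (a - m) ^ 2 + v by ring,
    ENNReal.ofReal_add (sq_nonneg _) v.coe_nonneg, ENNReal.ofReal_coe_nnreal]

/-! ### Change of mean for one Gaussian observation -/

section CameronMartin

variable {N₀ : ℝ≥0}

/-- Mean and variance share the factor a (the energy of the pilot). It cancels in the cross term of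
the exponent, so the density involves a and the observation only linearly. -/
lemma gaussianReal_shift (hN : 0 < N₀) (s : ℝ) (a : ℝ≥0) :
    gaussianReal (s * a) (a * (N₀ / 2)) =
      (gaussianReal 0 (a * (N₀ / 2))).withDensity (condLikRatio N₀ s a) := by
  have h2 : (0 : ℝ) < N₀ := hN
  have hm : Measurable (condLikRatio N₀ s a) := by unfold condLikRatio; fun_prop
  -- For a vanishing pilot both measures are the Dirac mass at 0, where the density is 1.
  rcases eq_or_ne a 0 with rfl | ha
  · simp only [zero_mul, gaussianReal_zero_var, NNReal.coe_zero, mul_zero]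
    ext t ht
    classical
    rw [withDensity_apply _ ht, restrict_dirac' ht]
    by_cases h : (0 : ℝ) ∈ t <;> simp [h, condLikRatio, ht]
  have ha' : (0 : ℝ) < a := by positivity
  have hv : a * (N₀ / 2) ≠ 0 := by positivity
  rw [gaussianReal_of_var_ne_zero _ hv, gaussianReal_of_var_ne_zero _ hv,
    ← withDensity_mul _ (measurable_gaussianPDF _ _) hm]
  congr 1
  ext w
  simp only [Pi.mul_apply, gaussianPDF, condLikRatio, gaussianPDFReal]
  rw [← ENNReal.ofReal_mul (by positivity), mul_assoc _ (Real.exp _) (Real.exp _), ← Real.exp_add]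
  congr 3
  push_cast
  field_simp
  ring

/-- Martingale property for a known channel. The exponent is additive in (u, v), so the ratio
factors, and the new factor integrates to 1 because it is the density of a probability measure. -/
lemma lintegral_condLikRatio_add (hN : 0 < N₀) (s u v : ℝ) (a : ℝ≥0) :
    ∫⁻ w, condLikRatio N₀ s (u + a) (v + w) ∂gaussianReal 0 (a * (N₀ / 2)) =
      condLikRatio N₀ s u v := by
  have hm : Measurable (condLikRatio N₀ s a) := by unfold condLikRatio; fun_prop
  have h1 : ∫⁻ w, condLikRatio N₀ s a w ∂gaussianReal 0 (a * (N₀ / 2)) = 1 := by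
    rw [← setLIntegral_univ, ← withDensity_apply _ MeasurableSet.univ, ← gaussianReal_shift hN]
    simp
  have h2 : ∀ w, condLikRatio N₀ s (u + a) (v + w) =
      condLikRatio N₀ s u v * condLikRatio N₀ s a w := by
    intro w
    rw [condLikRatio, condLikRatio, condLikRatio, ← ENNReal.ofReal_mul (by positivity),
      ← Real.exp_add]
    congr 2
    ring
  simp_rw [h2]
  rw [lintegral_const_mul _ hm, h1, mul_one]

end CameronMartin

/-! ### Finite product measures: densities and sums of Gaussians -/

section Product

variable {ι : Type*} [Fintype ι] {X : ι → Type*} [∀ i, MeasurableSpace (X i)]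

lemma lintegral_pi_prod (m : ∀ i, Measure (X i)) [∀ i, IsProbabilityMeasure (m i)]
    {f : ∀ i, X i → ℝ≥0∞} (hf : ∀ i, Measurable (f i)) :
    ∫⁻ z, ∏ i, f i (z i) ∂Measure.pi m = ∏ i, ∫⁻ z, f i z ∂m i := by
  have := lintegral_prod_eq_prod_lintegral_of_indepFun (μ := Measure.pi m) Finset.univ
    (fun i z => f i (z i)) (iIndepFun_pi fun i => (hf i).aemeasurable)
    (fun i => (hf i).comp (measurable_pi_apply i))
  rw [this]
  refine Finset.prod_congr rfl fun i _ => ?_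
  exact (measurePreserving_eval m i).lintegral_comp (hf i)

lemma pi_withDensity (m : ∀ i, Measure (X i)) [∀ i, IsProbabilityMeasure (m i)]
    {f : ∀ i, X i → ℝ≥0∞} (hf : ∀ i, Measurable (f i))
    [∀ i, SigmaFinite ((m i).withDensity (f i))] :
    Measure.pi (fun i => (m i).withDensity (f i)) =
      (Measure.pi m).withDensity fun z => ∏ i, f i (z i) := by
  refine Measure.pi_eq fun s hs => ?_
  rw [withDensity_apply _ (MeasurableSet.univ_pi hs), ← lintegral_indicator (.univ_pi hs)]
  have : ∀ z, (Set.univ.pi s).indicator (fun z => ∏ i, f i (z i)) z =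
      ∏ i, (s i).indicator (f i) (z i) := by
    intro z
    by_cases hz : z ∈ Set.univ.pi s
    · rw [Set.indicator_of_mem hz]
      exact Finset.prod_congr rfl fun i _ => (Set.indicator_of_mem (hz i trivial) _).symm
    · rw [Set.indicator_of_notMem hz]
      obtain ⟨i, hi⟩ : ∃ i, z i ∉ s i := by simpa [Set.mem_pi] using hz
      exact (Finset.prod_eq_zero (Finset.mem_univ i) (Set.indicator_of_notMem hi _)).symm
  simp_rw [this]
  rw [lintegral_pi_prod m fun i => (hf i).indicator (hs i)]
  refine Finset.prod_congr rfl fun i _ => ?_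
  rw [lintegral_indicator (hs i), withDensity_apply _ (hs i)]

lemma map_sum_pi_gaussianReal (m : ι → ℝ) (v : ι → ℝ≥0) :
    (Measure.pi fun i => gaussianReal (m i) (v i)).map (fun z => ∑ i, z i) =
      gaussianReal (∑ i, m i) (∑ i, v i) := by
  classical
  have hind : iIndepFun (fun i (z : ι → ℝ) => z i) (Measure.pi fun i => gaussianReal (m i) (v i)) :=
    iIndepFun_pi (X := fun _ => id) fun i => aemeasurable_id
  suffices h : ∀ s : Finset ι, (Measure.pi fun i => gaussianReal (m i) (v i)).map
      (fun z => ∑ i ∈ s, z i) = gaussianReal (∑ i ∈ s, m i) (∑ i ∈ s, v i) from h _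
  intro s
  induction s using Finset.induction_on with
  | empty => simp [Measure.map_const]
  | insert i s hi ih =>
    simp only [Finset.sum_insert hi]
    refine gaussianReal_add_gaussianReal_of_indepFun ?_ ?_ ?_
    · have := (hind.indepFun_finsetSum_of_notMem (fun i => measurable_pi_apply i) hi).symm
      convert this using 1
      ext z; simp
    · exact (measurePreserving_eval (fun i => gaussianReal (m i) (v i)) i).map_eq
    · exact ih

end Product

/-! ### The optimal cost as a function of the pilot energy -/

section OptimalCost

variable (μ : ℝ) (σ2 N₀ c₀ c₁ ce : ℝ≥0)

/-- Law of the statistic `V` under the null hypothesis, given that `U = u`. -/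
noncomputable def nullLaw (u : ℝ) : Measure ℝ := gaussianReal 0 (u.toNNReal * (N₀ / 2))

/-- Cost of deciding `0` when `(U, V) = (u, v)`, as a density with respect to the null hypothesis,
without the contribution of the posterior variance, which every decision incurs. -/
noncomputable def missCost (u v : ℝ) : ℝ≥0∞ :=
  likRatio μ σ2 N₀ u v * (c₁ + ce * ENNReal.ofReal (postMean μ σ2 N₀ u v ^ 2))

/-- The least conditional cost as a function of `U`. -/
noncomputable def optCost (u : ℝ) : ℝ≥0∞ :=
  ∫⁻ v, min (c₀ : ℝ≥0∞) (missCost μ σ2 N₀ c₁ ce u v) ∂nullLaw N₀ u + ce * postVar σ2 N₀ u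

instance (u : ℝ) : IsProbabilityMeasure (nullLaw N₀ u) := by unfold nullLaw; infer_instance

lemma measurable_missCost : Measurable fun z : ℝ × ℝ => missCost μ σ2 N₀ c₁ ce z.1 z.2 := by
  unfold missCost
  exact (measurable_likRatio μ σ2 N₀).mul
    ((((measurable_postMean μ σ2 N₀).pow_const 2).ennreal_ofReal.const_mul _).const_add _)

lemma measurable_likRatio_right (u : ℝ) : Measurable (likRatio μ σ2 N₀ u) := by
  unfold likRatio logLR; fun_prop

lemma measurable_missCost_right (u : ℝ) : Measurable (missCost μ σ2 N₀ c₁ ce u) := by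
  unfold missCost likRatio logLR postMean; fun_prop

variable {μ σ2 N₀ c₀ c₁ ce}

/-- A mixture over s of martingales is again a martingale under the null hypothesis. -/
lemma lintegral_likRatio_add (hσ : 0 < σ2) (hN : 0 < N₀) {u : ℝ} (hu : 0 ≤ u) (v : ℝ) (a : ℝ≥0) :
    ∫⁻ w, likRatio μ σ2 N₀ (u + a) (v + w) ∂gaussianReal 0 (a * (N₀ / 2)) =
      likRatio μ σ2 N₀ u v := by
  simp_rw [likRatio_eq_lintegral (μ := μ) hσ hN (add_nonneg hu a.coe_nonneg),
    likRatio_eq_lintegral (μ := μ) hσ hN hu]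
  rw [lintegral_lintegral_swap]
  · simp_rw [lintegral_condLikRatio_add hN]
  · unfold condLikRatio; fun_prop

lemma lintegral_likRatio_nullLaw (hσ : 0 < σ2) (hN : 0 < N₀) {u : ℝ} (hu : 0 ≤ u) :
    ∫⁻ v, likRatio μ σ2 N₀ u v ∂nullLaw N₀ u = 1 := by
  have h := lintegral_likRatio_add (μ := μ) hσ hN le_rfl 0 u.toNNReal
  simp only [zero_add, Real.coe_toNNReal u hu] at h
  rw [nullLaw, h, likRatio_eq_lintegral hσ hN le_rfl]
  simp [condLikRatio]

/-- The cost of deciding `0` is the mixture of the costs with known channel coefficient. -/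
lemma missCost_add_eq_lintegral (hσ : 0 < σ2) (hN : 0 < N₀) {u : ℝ} (hu : 0 ≤ u) (v : ℝ) :
    missCost μ σ2 N₀ c₁ ce u v + ce * (likRatio μ σ2 N₀ u v * postVar σ2 N₀ u) =
      ∫⁻ s, condLikRatio N₀ s u v * (c₁ + ce * ENNReal.ofReal (s ^ 2))
        ∂gaussianReal (μ / 2) (σ2 / 2) := by
  have hsq := lintegral_sq_sub_gaussianReal 0 (postMean μ σ2 N₀ u v) (postVar σ2 N₀ u)
  simp only [zero_sub, neg_sq] at hsq
  rw [lintegral_condLikRatio_mul hσ hN hu v (by fun_prop), lintegral_add_left measurable_const,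
    lintegral_const_mul _ (by fun_prop), hsq, missCost]
  simp only [lintegral_const, measure_univ, mul_one]
  ring

/-- `missCost` alone lacks the martingale property, since learning moves posterior variance into the
squared posterior mean. With the variance restored, the posterior second moment of the channel
appears, and the total is a mixture of the martingales for known s. -/
lemma lintegral_missCost_add (hσ : 0 < σ2) (hN : 0 < N₀) {u : ℝ} (hu : 0 ≤ u) (v : ℝ) (a : ℝ≥0) :
    ∫⁻ w, (missCost μ σ2 N₀ c₁ ce (u + a) (v + w)
        + ce * (likRatio μ σ2 N₀ (u + a) (v + w) * postVar σ2 N₀ (u + a)))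
        ∂gaussianReal 0 (a * (N₀ / 2)) =
      missCost μ σ2 N₀ c₁ ce u v + ce * (likRatio μ σ2 N₀ u v * postVar σ2 N₀ u) := by
  simp_rw [missCost_add_eq_lintegral (μ := μ) hσ hN (add_nonneg hu a.coe_nonneg),
    missCost_add_eq_lintegral (μ := μ) hσ hN hu]
  rw [lintegral_lintegral_swap]
  · refine lintegral_congr fun s => ?_
    rw [lintegral_mul_const, lintegral_condLikRatio_add hN]
    unfold condLikRatio; fun_prop
  · unfold condLikRatio; fun_prop

/-- The total conditional cost of the optimal decision given `(U, V)`. -/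
lemma optCost_eq_lintegral (hσ : 0 < σ2) (hN : 0 < N₀) {u : ℝ} (hu : 0 ≤ u) :
    optCost μ σ2 N₀ c₀ c₁ ce u =
      ∫⁻ v, (min (c₀ : ℝ≥0∞) (missCost μ σ2 N₀ c₁ ce u v)
        + ce * (likRatio μ σ2 N₀ u v * postVar σ2 N₀ u)) ∂nullLaw N₀ u := by
  have h1 := measurable_likRatio_right μ σ2 N₀ u
  have h2 := measurable_missCost_right μ σ2 N₀ c₁ ce u
  -- The posterior variance does not depend on v and the likelihood ratio integrates to 1, so the
  -- variance term is deterministic.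
  rw [lintegral_add_left (by fun_prop), lintegral_const_mul _ (by fun_prop),
    lintegral_mul_const _ h1, lintegral_likRatio_nullLaw hσ hN hu, one_mul, optCost]

lemma nullLaw_add {u : ℝ} (hu : 0 ≤ u) (a : ℝ≥0) :
    nullLaw N₀ (u + a) = (nullLaw N₀ u) ∗ (gaussianReal 0 (a * (N₀ / 2))) := by
  rw [nullLaw, nullLaw, gaussianReal_conv_gaussianReal, Real.toNNReal_add hu a.coe_nonneg,
    Real.toNNReal_coe, add_mul, add_zero]

/-- More pilot energy cannot increase the optimal cost. -/
lemma optCost_anti (hσ : 0 < σ2) (hN : 0 < N₀) {u u' : ℝ} (hu : 0 ≤ u) (h : u ≤ u') :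
    optCost μ σ2 N₀ c₀ c₁ ce u' ≤ optCost μ σ2 N₀ c₀ c₁ ce u := by
  obtain ⟨a, rfl⟩ : ∃ a : ℝ≥0, u' = u + a :=
    ⟨(u' - u).toNNReal, by rw [Real.coe_toNNReal _ (sub_nonneg.2 h)]; ring⟩
  have h1 := measurable_likRatio_right μ σ2 N₀ (u + a)
  have h2 := measurable_missCost_right μ σ2 N₀ c₁ ce (u + a)
  -- Under the null hypothesis, V at energy u + a is V at energy u plus an independent increment w;
  -- it suffices to compare for each value v of the former.
  rw [optCost_eq_lintegral hσ hN hu, optCost_eq_lintegral hσ hN (hu.trans h), nullLaw_add hu,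
    Measure.lintegral_conv (by fun_prop)]
  refine lintegral_mono fun v => ?_
  rw [← min_add_add_right]
  -- The average of a minimum is at most each of the two averages. The cost of deciding 1 decreases
  -- on average with the posterior variance; that of deciding 0 is preserved.
  refine le_min ?_ ?_
  · calc _ ≤ ∫⁻ w, ((c₀ : ℝ≥0∞) + ce * (likRatio μ σ2 N₀ (u + a) (v + w) * postVar σ2 N₀ (u + a)))
          ∂gaussianReal 0 (a * (N₀ / 2)) := lintegral_mono fun w => by
            dsimp only; rw [← min_add_add_right]; exact min_le_left _ _
      _ = c₀ + ce * (likRatio μ σ2 N₀ u v * postVar σ2 N₀ (u + a)) := by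
          rw [lintegral_add_left measurable_const, lintegral_const_mul _ (by fun_prop),
            lintegral_mul_const _ (by fun_prop), lintegral_likRatio_add hσ hN hu]
          simp
      _ ≤ _ := by
          gcongr
          exact postVar_anti hσ hN hu h
  · calc _ ≤ ∫⁻ w, (missCost μ σ2 N₀ c₁ ce (u + a) (v + w)
        + ce * (likRatio μ σ2 N₀ (u + a) (v + w) * postVar σ2 N₀ (u + a)))
          ∂gaussianReal 0 (a * (N₀ / 2)) := lintegral_mono fun w => by
            dsimp only; rw [← min_add_add_right]; exact min_le_right _ _
      _ = _ := lintegral_missCost_add hσ hN hu v a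

/-- Scaling a standard Gaussian moves the dependence on u from the measure to the integrand, as
dominated convergence and joint measurability require. For negative u both sides are the Dirac mass
at 0. -/
lemma nullLaw_eq_map (u : ℝ) :
    nullLaw N₀ u = (gaussianReal 0 1).map fun z => Real.sqrt (u * (N₀ / 2)) * z := by
  rw [gaussianReal_map_const_mul, nullLaw]
  congr 1
  · simp
  · ext
    rcases le_total 0 u with hu | hu
    · simp only [mul_one]
      push_cast
      rw [Real.sq_sqrt (by positivity), Real.coe_toNNReal _ hu]
    · have : u * (N₀ / 2) ≤ 0 := mul_nonpos_of_nonpos_of_nonneg hu (by positivity)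
      simp [Real.toNNReal_of_nonpos hu, Real.sqrt_eq_zero_of_nonpos this]

lemma optCost_eq_lintegral_std (u : ℝ) :
    optCost μ σ2 N₀ c₀ c₁ ce u =
      ∫⁻ z, min (c₀ : ℝ≥0∞) (missCost μ σ2 N₀ c₁ ce u (Real.sqrt (u * (N₀ / 2)) * z))
        ∂gaussianReal 0 1 + ce * postVar σ2 N₀ u := by
  have h2 := measurable_missCost_right μ σ2 N₀ c₁ ce u
  rw [optCost, nullLaw_eq_map, lintegral_map (by fun_prop) (by fun_prop)]

/-- Dominated convergence: the minimum with c₀ supplies the constant bound c₀. -/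
lemma tendsto_optCost {l : Filter ℝ} [l.IsCountablyGenerated] {g : ℝ → ℝ≥0∞} {b : ℝ≥0}
    (hg : ∀ z, Filter.Tendsto (fun u => missCost μ σ2 N₀ c₁ ce u (Real.sqrt (u * (N₀ / 2)) * z)) l
      (nhds (g z)))
    (hb : Filter.Tendsto (postVar σ2 N₀) l (nhds b)) :
    Filter.Tendsto (optCost μ σ2 N₀ c₀ c₁ ce) l
      (nhds (∫⁻ z, min (c₀ : ℝ≥0∞) (g z) ∂gaussianReal 0 1 + ce * b)) := by
  rw [funext (optCost_eq_lintegral_std (μ := μ) (σ2 := σ2) (c₀ := c₀) (c₁ := c₁) (ce := ce))]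
  refine Filter.Tendsto.add ?_ (ENNReal.Tendsto.const_mul (ENNReal.tendsto_coe.2 hb)
    (Or.inr ENNReal.coe_ne_top))
  refine tendsto_lintegral_filter_of_dominated_convergence (fun _ => c₀) ?_ ?_ ?_ ?_
  · refine Filter.Eventually.of_forall fun u => ?_
    have h2 := measurable_missCost_right μ σ2 N₀ c₁ ce u
    fun_prop
  · exact Filter.Eventually.of_forall fun u => Filter.Eventually.of_forall fun z => min_le_left _ _
  · simp
  · exact Filter.Eventually.of_forall fun z => tendsto_const_nhds.min (hg z)

lemma continuousAt_optCost (hσ : 0 < σ2) (hN : 0 < N₀) {u : ℝ} (hu : 0 ≤ u) :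
    ContinuousAt (optCost μ σ2 N₀ c₀ c₁ ce) u := by
  have h1 : (0 : ℝ) < σ2 := hσ
  have h2 : (0 : ℝ) < N₀ := hN
  have h3 : u + N₀ / σ2 ≠ 0 := by positivity
  have h4 : σ2 / N₀ * u + 1 ≠ 0 := by positivity
  have h5 : N₀ * (u + N₀ / σ2) ≠ 0 := by positivity
  have h : Filter.Tendsto (optCost μ σ2 N₀ c₀ c₁ ce) (nhds u) (nhds (∫⁻ z, min (c₀ : ℝ≥0∞)
      (missCost μ σ2 N₀ c₁ ce u (Real.sqrt (u * (N₀ / 2)) * z)) ∂gaussianReal 0 1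
        + ce * postVar σ2 N₀ u)) := by
    refine tendsto_optCost (fun z => ?_) ?_
    · have hL : ContinuousAt (fun u => logLR μ σ2 N₀ u (Real.sqrt (u * (N₀ / 2)) * z)) u := by
        unfold logLR
        fun_prop (disch := assumption)
      have hm : ContinuousAt (fun u => postMean μ σ2 N₀ u (Real.sqrt (u * (N₀ / 2)) * z)) u := by
        unfold postMean
        fun_prop (disch := assumption)
      have hl : ContinuousAt (fun u => likRatio μ σ2 N₀ u (Real.sqrt (u * (N₀ / 2)) * z)) u :=
        ENNReal.continuous_ofReal.continuousAt.comp hL.rexp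
      refine ENNReal.Tendsto.mul hl (Or.inr ?_) ?_ (Or.inr (likRatio_ne_top _ _))
      · exact ENNReal.add_ne_top.2 ⟨ENNReal.coe_ne_top,
          ENNReal.mul_ne_top ENNReal.coe_ne_top ENNReal.ofReal_ne_top⟩
      · exact tendsto_const_nhds.add (ENNReal.Tendsto.const_mul
          (ENNReal.tendsto_ofReal (hm.pow 2)) (Or.inr ENNReal.coe_ne_top))
    · have : ContinuousAt (postVar σ2 N₀) u := by
        unfold postVar
        exact continuous_real_toNNReal.continuousAt.comp
          (continuousAt_const.div (continuousAt_id.add continuousAt_const) h3)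
      exact this
  rwa [← optCost_eq_lintegral_std] at h

/-- Under the null hypothesis V is of order √U. So the posterior mean tends to 0, the quadratic term
of L stays bounded, and the logarithm drives L to -∞: a miss becomes free of charge. The posterior
variance vanishes too. -/
lemma tendsto_optCost_atTop (hσ : 0 < σ2) (hN : 0 < N₀) :
    Filter.Tendsto (optCost μ σ2 N₀ c₀ c₁ ce) Filter.atTop (nhds 0) := by
  have h1 : (0 : ℝ) < σ2 := hσ
  have h2 : (0 : ℝ) < N₀ := hN
  have hden : Filter.Tendsto (fun u : ℝ => u + N₀ / σ2) Filter.atTop Filter.atTop :=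
    Filter.tendsto_atTop_add_const_right _ _ Filter.tendsto_id
  have hpm (z : ℝ) : Filter.Tendsto (fun u => postMean μ σ2 N₀ u (Real.sqrt (u * (N₀ / 2)) * z))
      Filter.atTop (nhds 0) := by
    have hs : Filter.Tendsto (fun u : ℝ => Real.sqrt (u * (N₀ / 2))) Filter.atTop Filter.atTop :=
      Real.tendsto_sqrt_atTop.comp (Filter.tendsto_id.atTop_mul_const (by positivity))
    -- The posterior mean is split into factors with evident limits; `h5` and `h6` below identify
    -- them as √(uN₀/2)/u and u/(u + N₀/σ²).
    have hlim := (((hs.const_div_atTop (N₀ / 2 : ℝ)).mul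
      ((hden.const_div_atTop (N₀ / σ2 : ℝ)).const_sub 1)).mul_const z).add
      (hden.const_div_atTop (μ / 2 * (N₀ / σ2)))
    simp only [zero_mul, add_zero] at hlim
    refine hlim.congr' ?_
    filter_upwards [Filter.eventually_gt_atTop 0] with u hu
    have h3 : u + N₀ / σ2 ≠ 0 := by positivity
    have h4 : 0 < u * (N₀ / 2) := by positivity
    have h5 : (N₀ / 2 : ℝ) / Real.sqrt (u * (N₀ / 2)) = Real.sqrt (u * (N₀ / 2)) / u := by
      rw [div_eq_div_iff (Real.sqrt_ne_zero'.2 h4) hu.ne', Real.mul_self_sqrt h4.le, mul_comm]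
    have h6 : 1 - N₀ / σ2 / (u + N₀ / σ2) = u / (u + N₀ / σ2) := by
      rw [eq_div_iff h3, sub_mul, div_mul_cancel₀ _ h3]; ring
    rw [h5, h6, postMean, add_div]
    congr 1
    field_simp
  have hlr (z : ℝ) : Filter.Tendsto (fun u => logLR μ σ2 N₀ u (Real.sqrt (u * (N₀ / 2)) * z))
      Filter.atTop Filter.atBot := by
    have hlog : Filter.Tendsto (fun u : ℝ => Real.log (σ2 / N₀ * u + 1)) Filter.atTop
        Filter.atTop := Real.tendsto_log_atTop.comp (Filter.tendsto_atTop_add_const_right _ _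
          (Filter.tendsto_id.const_mul_atTop (by positivity)))
    -- The constant is the bound `hquad` below, uniform in u, from (A + B)² ≤ 2(A² + B²) with each
    -- square at most a constant times u + N₀/σ².
    have hbot := Filter.tendsto_atBot_add_const_left Filter.atTop
      (2 * (N₀ / 2 * z ^ 2 + (μ / 2 * (N₀ / σ2)) ^ 2 / (N₀ / σ2)) / N₀ - μ ^ 2 / (4 * σ2))
      (hlog.const_mul_atTop_of_neg (by norm_num : -(1 / 2 : ℝ) < 0))
    refine Filter.tendsto_atBot_mono' _ ?_ hbot
    filter_upwards [Filter.eventually_ge_atTop 0] with u hu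
    have h3 : 0 < u + N₀ / σ2 := by positivity
    have hsq : (Real.sqrt (u * (N₀ / 2)) * z) ^ 2 = u * (N₀ / 2) * z ^ 2 := by
      rw [mul_pow, Real.sq_sqrt (by positivity)]
    have hquad : (Real.sqrt (u * (N₀ / 2)) * z + μ / 2 * (N₀ / σ2)) ^ 2 / (N₀ * (u + N₀ / σ2)) ≤
        2 * (N₀ / 2 * z ^ 2 + (μ / 2 * (N₀ / σ2)) ^ 2 / (N₀ / σ2)) / N₀ := by
      generalize hA : Real.sqrt (u * (N₀ / 2)) * z = A at *
      generalize hB : μ / 2 * (N₀ / σ2 : ℝ) = B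
      have hr : (0 : ℝ) < N₀ / σ2 := by positivity
      generalize (N₀ / σ2 : ℝ) = r at *
      rw [div_le_div_iff₀ (by positivity) h2]
      have hAB : (A + B) ^ 2 ≤ 2 * (A ^ 2 + B ^ 2) := by nlinarith [sq_nonneg (A - B)]
      have hB2 : B ^ 2 ≤ B ^ 2 / r * (u + r) := by
        rw [mul_add, div_mul_cancel₀ _ hr.ne']
        have : 0 ≤ B ^ 2 / r * u := by positivity
        linarith
      have hA2 : A ^ 2 ≤ N₀ / 2 * z ^ 2 * (u + r) := by
        rw [hsq]
        have : 0 ≤ N₀ / 2 * z ^ 2 * r := by positivity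
        linarith
      calc (A + B) ^ 2 * N₀ ≤ 2 * (N₀ / 2 * z ^ 2 * (u + r) + B ^ 2 / r * (u + r)) * N₀ := by
            gcongr; linarith
        _ = _ := by ring
    rw [logLR]
    linarith
  have h := tendsto_optCost (μ := μ) (σ2 := σ2) (N₀ := N₀) (c₀ := c₀) (c₁ := c₁) (ce := ce)
    (l := Filter.atTop) (g := 0) (b := 0) (fun z => ?_) ?_
  · simpa using h
  · have hl : Filter.Tendsto (fun u => likRatio μ σ2 N₀ u (Real.sqrt (u * (N₀ / 2)) * z))
        Filter.atTop (nhds 0) := by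
      have := ENNReal.tendsto_ofReal (Real.tendsto_exp_atBot.comp (hlr z))
      rwa [ENNReal.ofReal_zero] at this
    have hk : Filter.Tendsto (fun u => (c₁ : ℝ≥0∞) + ce * ENNReal.ofReal
        (postMean μ σ2 N₀ u (Real.sqrt (u * (N₀ / 2)) * z) ^ 2)) Filter.atTop (nhds c₁) := by
      simpa using tendsto_const_nhds.add (ENNReal.Tendsto.const_mul (a := (ce : ℝ≥0∞))
        (ENNReal.tendsto_ofReal ((hpm z).pow 2)) (Or.inr ENNReal.coe_ne_top))
    have := ENNReal.Tendsto.mul hl (Or.inr ENNReal.coe_ne_top) hk (Or.inr ENNReal.zero_ne_top)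
    rwa [zero_mul] at this
  · have := (continuous_real_toNNReal.tendsto _).comp (hden.const_div_atTop (N₀ / 2 : ℝ))
    rwa [Real.toNNReal_zero] at this

/-- The cost constraint is a lower bound on the pilot energy. -/
lemma exists_energy_threshold (μ : ℝ) (c₀ c₁ ce : ℝ≥0) {α : ℝ≥0} (hσ : 0 < σ2) (hN : 0 < N₀)
    (hα : 0 < α) :
    ∃ γ : ℝ, ∀ u, 0 ≤ u → (optCost μ σ2 N₀ c₀ c₁ ce u ≤ α ↔ γ ≤ u) := by
  -- The limit 0 < α makes this set nonempty, continuity makes it closed, so it contains its infimum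
  -- γ; monotonicity then gives everything above γ.
  set S : Set ℝ := Set.Ici 0 ∩ optCost μ σ2 N₀ c₀ c₁ ce ⁻¹' Set.Iic (α : ℝ≥0∞) with hS
  have hclosed : IsClosed S := ContinuousOn.preimage_isClosed_of_isClosed
    (fun u hu => (continuousAt_optCost hσ hN hu).continuousWithinAt) isClosed_Ici isClosed_Iic
  have hne : S.Nonempty := by
    have hlt : ∀ᶠ u in Filter.atTop, optCost μ σ2 N₀ c₀ c₁ ce u < α :=
      (tendsto_optCost_atTop hσ hN).eventually_lt_const (by simpa using hα)
    obtain ⟨u, hu, hu0⟩ := (hlt.and (Filter.eventually_ge_atTop 0)).exists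
    exact ⟨u, hu0, hu.le⟩
  have hbdd : BddBelow S := ⟨0, fun u hu => hu.1⟩
  have hmem := hclosed.csInf_mem hne hbdd
  exact ⟨sInf S, fun u hu => ⟨fun h => csInf_le hbdd ⟨hu, h⟩,
    fun h => (optCost_anti hσ hN hmem.1 h).trans hmem.2⟩⟩

end OptimalCost

/-! ### Laws of the noise given a pilot path -/

section Laws

variable {N₀ : ℝ≥0}

/-- Law of the noises up to time `t` given the pilot path `q`. -/
noncomputable def noiseLawUpTo (N₀ : ℝ≥0) (t : ℕ) (q : ℕ → ℂ) : Measure (Finset.range t → ℝ) :=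
  Measure.pi fun i => gaussianReal 0 (‖q i‖₊ ^ 2 * (N₀ / 2))

instance (t : ℕ) (q : ℕ → ℂ) : IsProbabilityMeasure (noiseLawUpTo N₀ t q) := by
  unfold noiseLawUpTo; infer_instance

instance (q : ℕ → ℂ) : IsProbabilityMeasure (noiseLaw N₀ q) := by
  unfold noiseLaw; infer_instance

/-- Energy of a pilot path up to time `t`. -/
noncomputable def energy (t : ℕ) (q : ℕ → ℂ) : ℝ := ∑ i ∈ Finset.range t, ‖q i‖ ^ 2

lemma energy_nonneg (t : ℕ) (q : ℕ → ℂ) : 0 ≤ energy t q := by unfold energy; positivity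

lemma measurable_energy (t : ℕ) : Measurable (energy t) := by unfold energy; fun_prop

lemma map_restrict_noiseLaw (t : ℕ) (q : ℕ → ℂ) :
    (noiseLaw N₀ q).map (Finset.range t).restrict = noiseLawUpTo N₀ t q := by
  rw [noiseLaw, Measure.infinitePi_map_restrict, noiseLawUpTo]

lemma map_sum_noiseLawUpTo (t : ℕ) (q : ℕ → ℂ) :
    (noiseLawUpTo N₀ t q).map (fun w => ∑ i, w i) = nullLaw N₀ (energy t q) := by
  rw [noiseLawUpTo, map_sum_pi_gaussianReal, nullLaw, Finset.sum_const_zero, ← Finset.sum_mul]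
  congr 2
  ext
  rw [Real.coe_toNNReal _ (energy_nonneg t q), energy, NNReal.coe_sum]
  exact Finset.sum_coe_sort (Finset.range t) fun i => ‖q i‖ ^ 2

/-- The coordinate densities multiply, so their exponents add and only the energy and the sum of the
observations survive: (U, V) is sufficient. -/
lemma noiseLawUpTo_shift (hN : 0 < N₀) (t : ℕ) (q : ℕ → ℂ) (s : ℝ) :
    (noiseLawUpTo N₀ t q).map (fun (w : Finset.range t → ℝ) i => w i + s * ‖q i‖ ^ 2) =
      (noiseLawUpTo N₀ t q).withDensity fun w => condLikRatio N₀ s (energy t q) (∑ i, w i) := by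
  have hshift : ∀ i : Finset.range t, (gaussianReal 0 (‖q i‖₊ ^ 2 * (N₀ / 2))).map
      (fun w => w + s * ‖q i‖ ^ 2) = (gaussianReal 0 (‖q i‖₊ ^ 2 * (N₀ / 2))).withDensity
        (condLikRatio N₀ s ((‖q i‖₊ ^ 2 : ℝ≥0) : ℝ)) := by
    intro i
    rw [gaussianReal_map_add_const, ← gaussianReal_shift hN]
    simp
  have hprob : ∀ i : Finset.range t, IsProbabilityMeasure
      ((gaussianReal 0 (‖q i‖₊ ^ 2 * (N₀ / 2))).withDensity
        (condLikRatio N₀ s ((‖q i‖₊ ^ 2 : ℝ≥0) : ℝ))) := by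
    intro i
    rw [← gaussianReal_shift hN]
    infer_instance
  have hm : ∀ u : ℝ, Measurable (condLikRatio N₀ s u) := by
    intro u; unfold condLikRatio; fun_prop
  rw [noiseLawUpTo, Measure.pi_map_pi (f := fun (i : Finset.range t) (w : ℝ) => w + s * ‖q i‖ ^ 2)
    fun i => by fun_prop]
  simp_rw [hshift]
  rw [pi_withDensity _ fun i => hm _]
  congr 1
  ext w
  simp only [condLikRatio]
  rw [← ENNReal.ofReal_prod_of_nonneg fun i _ => (Real.exp_pos _).le, ← Real.exp_sum,
    ← Finset.sum_div, Finset.sum_sub_distrib, ← Finset.mul_sum, ← Finset.mul_sum, energy,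
    ← Finset.sum_coe_sort (Finset.range t) fun i => ‖q i‖ ^ 2]
  simp

end Laws

/-! ### Disintegration and change of measure -/

section Model

variable {Ω : Type*} {p : ℕ → Ω → ℂ} {y : ℕ → Ω → ℝ}

/-- The observations up to time `t`. -/
def obsUpTo (y : ℕ → Ω → ℝ) (t : ℕ) (ω : Ω) : Finset.range t → ℝ := fun i => y i ω

lemma sum_obsUpTo (t : ℕ) (ω : Ω) : ∑ i, obsUpTo y t ω i = V y t ω := by
  exact Finset.sum_coe_sort (Finset.range t) fun m => y m ω

lemma energy_pilot (t : ℕ) (ω : Ω) : energy t (fun m => p m ω) = U p t ω := rfl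

lemma U_nonneg (t : ℕ) (ω : Ω) : 0 ≤ U p t ω := by unfold U; positivity

namespace IsChannelModel

variable [mΩ : MeasurableSpace Ω] {μ : ℝ} {σ2 N₀ : ℝ≥0} {P₀ P₁ : Measure Ω}
  [IsProbabilityMeasure P₀] [IsProbabilityMeasure P₁] {x : Ω → ℝ}

lemma measurable_pilots (hM : IsChannelModel μ σ2 N₀ P₀ P₁ p y x) :
    Measurable fun ω m => p m ω := measurable_pi_lambda _ hM.measurable_pilot

lemma measurable_noise (hM : IsChannelModel μ σ2 N₀ P₀ P₁ p y x) (m : ℕ) :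
    Measurable (noise p y x m) := by
  have := hM.measurable_pilot m
  have := hM.measurable_obs m
  have := hM.measurable_channel
  unfold noise
  fun_prop

/-- Disintegration of the law of pilots and observations under the null hypothesis. -/
lemma lintegral_null (hM : IsChannelModel μ σ2 N₀ P₀ P₁ p y x)
    (t : ℕ) {Φ : (ℕ → ℂ) × (Finset.range t → ℝ) → ℝ≥0∞} (hΦ : Measurable Φ) :
    ∫⁻ ω, Φ (fun m => p m ω, obsUpTo y t ω) ∂P₀ =
      ∫⁻ q, ∫⁻ w, Φ (q, w) ∂noiseLawUpTo N₀ t q ∂P₀.map fun ω m => p m ω := by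
  have hp := hM.measurable_pilots
  have hy : Measurable fun ω m => y m ω := measurable_pi_lambda _ hM.measurable_obs
  have hΨ : Measurable fun z : (ℕ → ℂ) × (ℕ → ℝ) => Φ (z.1, (Finset.range t).restrict z.2) := by
    fun_prop
  have h1 : ∫⁻ ω, Φ (fun m => p m ω, obsUpTo y t ω) ∂P₀ =
      ∫⁻ z, Φ (z.1, (Finset.range t).restrict z.2)
        ∂P₀.map (fun ω => ((fun m => p m ω), fun m => y m ω)) := by
    rw [lintegral_map hΨ (hp.prodMk hy)]; rfl
  rw [h1, ← compProd_map_condDistrib hy.aemeasurable, Measure.lintegral_compProd hΨ]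
  refine lintegral_congr_ae ?_
  filter_upwards [hM.obs_H0] with q hq
  rw [hq, ← map_restrict_noiseLaw, lintegral_map (by fun_prop) (by fun_prop)]

/-- Disintegration of the law of pilots, observations and channel under the alternative. -/
lemma lintegral_alt (hM : IsChannelModel μ σ2 N₀ P₀ P₁ p y x)
    (t : ℕ) {Φ : (ℕ → ℂ) × (Finset.range t → ℝ) × ℝ → ℝ≥0∞} (hΦ : Measurable Φ) :
    ∫⁻ ω, Φ (fun m => p m ω, obsUpTo y t ω, x ω) ∂P₁ =
      ∫⁻ q, ∫⁻ w, ∫⁻ s, Φ (q, fun i => w i + s * ‖q i‖ ^ 2, s) ∂gaussianReal (μ / 2) (σ2 / 2)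
        ∂noiseLawUpTo N₀ t q ∂P₁.map fun ω m => p m ω := by
  have hp := hM.measurable_pilots
  have hx := hM.measurable_channel
  have hn : Measurable fun ω m => noise p y x m ω := measurable_pi_lambda _ hM.measurable_noise
  have hΨ : Measurable fun z : ((ℕ → ℂ) × (ℕ → ℝ)) × ℝ =>
      Φ (z.1.1, (fun i : Finset.range t => z.1.2 i + z.2 * ‖z.1.1 i‖ ^ 2), z.2) := by
    fun_prop
  have h1 : ∫⁻ ω, Φ (fun m => p m ω, obsUpTo y t ω, x ω) ∂P₁ =
      ∫⁻ z, Φ (z.1.1, (fun i : Finset.range t => z.1.2 i + z.2 * ‖z.1.1 i‖ ^ 2), z.2)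
        ∂P₁.map (fun ω => (((fun m => p m ω), fun m => noise p y x m ω), x ω)) := by
    rw [lintegral_map hΨ ((hp.prodMk hn).prodMk hx)]
    refine lintegral_congr fun ω => ?_
    congr 3
    ext i
    simp [noise, obsUpTo]
  rw [h1, (indepFun_iff_map_prod_eq_prod_map_map (hp.prodMk hn).aemeasurable hx.aemeasurable).1
    hM.indep.symm, hM.channel_law, lintegral_prod _ hΨ.aemeasurable,
    ← compProd_map_condDistrib hn.aemeasurable, Measure.lintegral_compProd hΨ.lintegral_prod_right']
  refine lintegral_congr_ae ?_
  filter_upwards [hM.noise_H1] with q hq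
  have hΨ' : Measurable fun z : (Finset.range t → ℝ) × ℝ =>
      Φ (q, (fun i => z.1 i + z.2 * ‖q i‖ ^ 2), z.2) := by fun_prop
  rw [hq, ← map_restrict_noiseLaw, lintegral_map hΨ'.lintegral_prod_right' (by fun_prop)]
  rfl

/-- Change of measure: under the alternative, pilots and observations have density `exp L_t` and
the posterior law of the channel coefficient is Gaussian. -/
lemma lintegral_alt_eq_null (hM : IsChannelModel μ σ2 N₀ P₀ P₁ p y x)
    (hσ : 0 < σ2) (hN : 0 < N₀) (t : ℕ)
    {Φ : (ℕ → ℂ) × (Finset.range t → ℝ) × ℝ → ℝ≥0∞} (hΦ : Measurable Φ) :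
    ∫⁻ ω, Φ (fun m => p m ω, obsUpTo y t ω, x ω) ∂P₁ =
      ∫⁻ ω, likRatio μ σ2 N₀ (U p t ω) (V y t ω) *
        ∫⁻ s, Φ (fun m => p m ω, obsUpTo y t ω, s)
          ∂gaussianReal (postMean μ σ2 N₀ (U p t ω) (V y t ω)) (postVar σ2 N₀ (U p t ω)) ∂P₀ := by
  have hmeas : Measurable fun z : ((ℕ → ℂ) × (Finset.range t → ℝ)) × ℝ =>
      condLikRatio N₀ z.2 (energy t z.1.1) (∑ i, z.1.2 i) * Φ (z.1.1, z.1.2, z.2) := by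
    have := measurable_energy t
    unfold condLikRatio
    fun_prop
  have h0 := hM.lintegral_null t (hmeas.lintegral_prod_right' (ν := gaussianReal (μ / 2) (σ2 / 2)))
  have hbayes : ∀ ω, ∫⁻ s, condLikRatio N₀ s (energy t fun m => p m ω) (∑ i, obsUpTo y t ω i) *
      Φ (fun m => p m ω, obsUpTo y t ω, s) ∂gaussianReal (μ / 2) (σ2 / 2) =
      likRatio μ σ2 N₀ (U p t ω) (V y t ω) * ∫⁻ s, Φ (fun m => p m ω, obsUpTo y t ω, s)
        ∂gaussianReal (postMean μ σ2 N₀ (U p t ω) (V y t ω)) (postVar σ2 N₀ (U p t ω)) := by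
    intro ω
    rw [sum_obsUpTo, energy_pilot, lintegral_condLikRatio_mul hσ hN (U_nonneg t ω) _ (by fun_prop)]
  -- Bayes' formula is read backwards: with the prior average restored, only the shift for a fixed s
  -- is left to compare.
  simp_rw [← hbayes]
  rw [hM.lintegral_alt t hΦ, h0, hM.pilot_law]
  refine lintegral_congr fun q => ?_
  have h1 : Measurable fun z : (Finset.range t → ℝ) × ℝ =>
      Φ (q, (fun i => z.1 i + z.2 * ‖q i‖ ^ 2), z.2) := by fun_prop
  have h2 : Measurable fun z : (Finset.range t → ℝ) × ℝ =>
      condLikRatio N₀ z.2 (energy t q) (∑ i, z.1 i) * Φ (q, z.1, z.2) := by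
    unfold condLikRatio; fun_prop
  -- The channel value is integrated last, so that it is a constant in the Cameron–Martin shift.
  rw [lintegral_lintegral_swap (μ := noiseLawUpTo N₀ t q)
      (f := fun w s => Φ (q, fun i => w i + s * ‖q i‖ ^ 2, s)) h1.aemeasurable,
    lintegral_lintegral_swap (μ := noiseLawUpTo N₀ t q)
      (f := fun w s => condLikRatio N₀ s (energy t q) (∑ i, w i) * Φ (q, w, s)) h2.aemeasurable]
  refine lintegral_congr fun s => ?_
  have h3 : Measurable fun w : Finset.range t → ℝ => Φ (q, w, s) := by fun_prop
  have h4 : Measurable fun w : Finset.range t → ℝ => condLikRatio N₀ s (energy t q) (∑ i, w i) := by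
    unfold condLikRatio; fun_prop
  rw [← lintegral_map (f := fun w => Φ (q, w, s))
    (g := fun (w : Finset.range t → ℝ) i => w i + s * ‖q i‖ ^ 2) h3 (by fun_prop),
    noiseLawUpTo_shift hN, lintegral_withDensity_eq_lintegral_mul _ h4 h3]
  rfl

end IsChannelModel

end Model

lemma measurable_lintegral_nullLaw (N₀ : ℝ≥0) {φ : ℝ × ℝ → ℝ≥0∞} (hφ : Measurable φ) :
    Measurable fun u => ∫⁻ v, φ (u, v) ∂nullLaw N₀ u := by
  have h : ∀ u, ∫⁻ v, φ (u, v) ∂nullLaw N₀ u =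
      ∫⁻ z, φ (u, Real.sqrt (u * (N₀ / 2)) * z) ∂gaussianReal 0 1 := by
    intro u
    rw [nullLaw_eq_map, lintegral_map (by fun_prop) (by fun_prop)]
  simp_rw [h]
  exact Measurable.lintegral_prod_right'
    (f := fun z : ℝ × ℝ => φ (z.1, Real.sqrt (z.1 * (N₀ / 2)) * z.2)) (by fun_prop)

/-! ### Measurability at a stopping time -/

section Stopping

variable {Ω β : Type*} {m : MeasurableSpace Ω} [MeasurableSpace β] {f : Filtration ℕ m}
  {τ : Ω → WithTop ℕ}

/-- The σ-algebras at τ and at t have the same trace on the event τ = t, which reduces stopped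
quantities to a fixed time. -/
lemma measurable_indicator_eq [Zero β] (hτ : IsStoppingTime f τ) {g : Ω → β}
    (hg : Measurable[hτ.measurableSpace] g) (t : ℕ) :
    Measurable[f t] ({ω | τ ω = WithTop.some t}.indicator g) := by
  intro s hs
  rw [Set.indicator_preimage]
  exact ((hτ.measurableSet_inter_eq_iff _ t).1
    (MeasurableSet.inter (hg hs) (hτ.measurableSet_eq_of_countable' t))).union
    (MeasurableSet.diff (@measurable_const β Ω _ (f t) 0 s hs) (hτ.measurableSet_eq t))

lemma measurable_stoppedValue_of_adapted (hτ : IsStoppingTime f τ) {u : ℕ → Ω → β}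
    (hu : ∀ t, Measurable[f t] (u t)) : Measurable[hτ.measurableSpace] (stoppedValue u τ) := by
  intro s hs
  have hval : ∀ (i : ℕ) ω, τ ω = WithTop.some i → stoppedValue u τ ω = u i ω := by
    intro i ω h; rw [stoppedValue, h]; rfl
  have heq : ∀ i : ℕ, MeasurableSet[f i] (stoppedValue u τ ⁻¹' s ∩ {ω | τ ω = WithTop.some i}) := by
    intro i
    have : stoppedValue u τ ⁻¹' s ∩ {ω | τ ω = WithTop.some i} =
        u i ⁻¹' s ∩ {ω | τ ω = WithTop.some i} := by
      ext ω
      simp only [Set.mem_inter_iff, Set.mem_preimage, Set.mem_ofPred_eq, and_congr_left_iff]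
      intro h
      rw [hval i ω h]
    rw [this]
    exact (hu i hs).inter (hτ.measurableSet_eq i)
  refine (hτ.measurableSet _).2 ⟨?_, fun i => ?_⟩
  -- Where τ = ⊤ the stopped value reads the fixed default index `untopA`, hence the last piece.
  · have hdec : stoppedValue u τ ⁻¹' s =
        (⋃ i : ℕ, stoppedValue u τ ⁻¹' s ∩ {ω | τ ω = WithTop.some i}) ∪
        (u (⊤ : WithTop ℕ).untopA ⁻¹' s ∩ (⋃ i : ℕ, {ω | τ ω = WithTop.some i})ᶜ) := by
      ext ω
      rcases h : τ ω with _ | i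
      · have h' : τ ω = ⊤ := h
        simp [stoppedValue, h']
      · have h' : τ ω = WithTop.some i := h
        simp [h']
    rw [hdec]
    refine MeasurableSet.union (.iUnion fun i => le_iSup f i _ (heq i))
      (.inter (le_iSup f _ _ (hu _ hs)) (.compl (.iUnion fun i => ?_)))
    exact le_iSup f i _ (hτ.measurableSet_eq i)
  · have hdec : stoppedValue u τ ⁻¹' s ∩ {ω | τ ω ≤ WithTop.some i} =
        ⋃ j : ℕ, ⋃ _ : j ≤ i, stoppedValue u τ ⁻¹' s ∩ {ω | τ ω = WithTop.some j} := by
      ext ω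
      rcases h : τ ω with _ | k
      · have h' : τ ω = ⊤ := h
        simp [h']
      · have h' : τ ω = WithTop.some k := h
        simp [h', and_comm]
    rw [hdec]
    exact .iUnion fun j => .iUnion fun hj => f.mono hj _ (heq j)

end Stopping

/-! ### The histories in terms of pilots and observations -/

section History

variable {Ω : Type*} [mΩ : MeasurableSpace Ω] {p : ℕ → Ω → ℂ} {y : ℕ → Ω → ℝ}

/-- The pairs of observations and pilots up to time `t`. -/
def pairsUpTo (p : ℕ → Ω → ℂ) (y : ℕ → Ω → ℝ) (t : ℕ) (ω : Ω) : Finset.range t → ℝ × ℂ :=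
  fun i => (y i ω, p i ω)

lemma obsHistory_eq_comap (hp : ∀ m, Measurable (p m)) (hy : ∀ m, Measurable (y m)) (t : ℕ) :
    obsHistory p y hp hy t = MeasurableSpace.comap (pairsUpTo p y t) inferInstance := by
  change (⨆ m, ⨆ _ : m < t, MeasurableSpace.comap (fun ω => (y m ω, p m ω)) inferInstance) =
    MeasurableSpace.comap (pairsUpTo p y t) MeasurableSpace.pi
  simp only [MeasurableSpace.pi, MeasurableSpace.comap_iSup, MeasurableSpace.comap_comp]
  rw [iSup_subtype]
  simp only [Finset.mem_range]
  rfl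

lemma pilotHistory_le_comap (hp : ∀ m, Measurable (p m)) (t : ℕ) :
    pilotHistory p hp t ≤ MeasurableSpace.comap (fun ω m => p m ω) inferInstance := by
  refine iSup_le fun m => iSup_le fun _ => ?_
  have h : p m = (fun q : ℕ → ℂ => q m) ∘ fun ω m => p m ω := rfl
  rw [h, ← MeasurableSpace.comap_comp]
  exact MeasurableSpace.comap_mono (measurable_pi_apply m).comap_le

lemma measurable_U (hp : ∀ m, Measurable (p m)) (t : ℕ) :
    Measurable[pilotHistory p hp t] (U p t) := by
  refine Finset.measurable_fun_sum _ fun m hm => ?_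
  have : Measurable[pilotHistory p hp t] (p m) :=
    (comap_measurable (p m)).mono (le_iSup_of_le m (le_iSup_of_le (Finset.mem_range.1 hm) le_rfl))
      le_rfl
  exact (measurable_norm.pow_const 2).comp this

lemma measurable_V (hp : ∀ m, Measurable (p m)) (hy : ∀ m, Measurable (y m)) (t : ℕ) :
    Measurable[obsHistory p y hp hy t] (V y t) := by
  refine Finset.measurable_fun_sum _ fun m hm => ?_
  have : Measurable[obsHistory p y hp hy t] fun ω => (y m ω, p m ω) :=
    (comap_measurable _).mono (le_iSup_of_le m (le_iSup_of_le (Finset.mem_range.1 hm) le_rfl))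
      le_rfl
  exact measurable_fst.comp this

lemma measurable_UV (hp : ∀ m, Measurable (p m)) (hy : ∀ m, Measurable (y m)) (t : ℕ) :
    Measurable[obsHistory p y hp hy t] fun ω => (U p t ω, V y t ω) :=
  ((measurable_U hp t).mono (pilotHistory_le_obsHistory p y hp hy t) le_rfl).prodMk
    (measurable_V hp hy t)

end History

/-! ### Integrals over events of the histories -/

namespace IsChannelModel

variable {Ω : Type*} [mΩ : MeasurableSpace Ω] {p : ℕ → Ω → ℂ} {y : ℕ → Ω → ℝ} {x : Ω → ℝ}
  {μ : ℝ} {σ2 N₀ : ℝ≥0} {P₀ P₁ : Measure Ω} [IsProbabilityMeasure P₀] [IsProbabilityMeasure P₁]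

/-- A function of the pilots up to time `t` has the same integral under both hypotheses. -/
lemma lintegral_pilot_eq (hM : IsChannelModel μ σ2 N₀ P₀ P₁ p y x) {t : ℕ} {f : Ω → ℝ≥0∞}
    (hf : Measurable[pilotHistory p hM.measurable_pilot t] f) : ∫⁻ ω, f ω ∂P₀ = ∫⁻ ω, f ω ∂P₁ := by
  obtain ⟨g, hg, rfl⟩ := (hf.mono (pilotHistory_le_comap _ t) le_rfl).exists_eq_measurable_comp
  have h0 := lintegral_map hg hM.measurable_pilots (μ := P₀)
  have h1 := lintegral_map hg hM.measurable_pilots (μ := P₁)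
  rw [hM.pilot_law, h1] at h0
  exact h0.symm

/-- Pilot events have the same probability under both hypotheses, so all comparisons can be made
under `P₀`. -/
lemma ae_add_of_ae_null (hM : IsChannelModel μ σ2 N₀ P₀ P₁ p y x) {t : ℕ} {s : Set Ω}
    (hs : MeasurableSet[pilotHistory p hM.measurable_pilot t] s) (h : ∀ᵐ ω ∂P₀, ω ∈ s) :
    ∀ᵐ ω ∂(P₀ + P₁), ω ∈ s := by
  rw [ae_add_measure_iff]
  refine ⟨h, ?_⟩
  have hle := (pilotHistory p hM.measurable_pilot).le t
  have h1 := hM.lintegral_pilot_eq (t := t) (f := sᶜ.indicator 1)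
    (Measurable.indicator (@measurable_const ℝ≥0∞ Ω _ (pilotHistory p hM.measurable_pilot t) 1)
      hs.compl)
  rw [lintegral_indicator_one (hle _ hs.compl), lintegral_indicator_one (hle _ hs.compl)] at h1
  rw [ae_iff] at h ⊢
  exact h1.symm.trans h

/-- Comparison of functions of the pilots, on a part of the space, through their integrals. -/
lemma ae_le_of_forall_setLIntegral_le (hM : IsChannelModel μ σ2 N₀ P₀ P₁ p y x) {t : ℕ} {A : Set Ω}
    (hA : MeasurableSet[pilotHistory p hM.measurable_pilot t] A) {f g : Ω → ℝ≥0∞}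
    (hf : Measurable[pilotHistory p hM.measurable_pilot t] (A.indicator f))
    (hg : Measurable[pilotHistory p hM.measurable_pilot t] (A.indicator g))
    (h : ∀ B, MeasurableSet[pilotHistory p hM.measurable_pilot t] B → B ⊆ A →
      ∫⁻ ω in B, f ω ∂P₀ ≤ ∫⁻ ω in B, g ω ∂P₀) :
    ∀ᵐ ω ∂(P₀ + P₁), ω ∈ A → f ω ≤ g ω := by
  have hle := (pilotHistory p hM.measurable_pilot).le t
  have hset : MeasurableSet[pilotHistory p hM.measurable_pilot t]
      {ω | A.indicator f ω ≤ A.indicator g ω} := measurableSet_le hf hg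
  have key : A.indicator f ≤ᵐ[P₀] A.indicator g := by
    refine ae_le_of_ae_le_trim (hm := hle) ?_
    refine ae_le_of_forall_setLIntegral_le_of_sigmaFinite hf fun B hB _ => ?_
    rw [setLIntegral_trim hle hf hB, setLIntegral_trim hle hg hB,
      setLIntegral_indicator (hle _ hA), setLIntegral_indicator (hle _ hA)]
    exact h _ (hA.inter hB) Set.inter_subset_left
  filter_upwards [hM.ae_add_of_ae_null hset key] with ω hω hωA
  simpa [hωA] using hω

/-- Change of measure for functions of the channel and the observations up to time `t`. -/
lemma lintegral_pairs_alt (hM : IsChannelModel μ σ2 N₀ P₀ P₁ p y x) (hσ : 0 < σ2) (hN : 0 < N₀)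
    (t : ℕ) {Φ : (Finset.range t → ℝ × ℂ) × ℝ → ℝ≥0∞} (hΦ : Measurable Φ) :
    ∫⁻ ω, Φ (pairsUpTo p y t ω, x ω) ∂P₁ =
      ∫⁻ ω, likRatio μ σ2 N₀ (U p t ω) (V y t ω) * ∫⁻ s, Φ (pairsUpTo p y t ω, s)
        ∂gaussianReal (postMean μ σ2 N₀ (U p t ω) (V y t ω)) (postVar σ2 N₀ (U p t ω)) ∂P₀ :=
  hM.lintegral_alt_eq_null hσ hN t (Φ := fun z => Φ (fun i => (z.2.1 i, z.1 i), z.2.2))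
    (by fun_prop)

/-- Given the observations, `a` and `g` are constants and the channel follows its Gaussian
posterior, so the error is squared bias plus posterior variance. -/
lemma lintegral_sq_alt (hM : IsChannelModel μ σ2 N₀ P₀ P₁ p y x) (hσ : 0 < σ2) (hN : 0 < N₀)
    {t : ℕ} {a : Ω → ℝ≥0∞} {g : Ω → ℝ}
    (ha : Measurable[obsHistory p y hM.measurable_pilot hM.measurable_obs t] a)
    (hg : Measurable[obsHistory p y hM.measurable_pilot hM.measurable_obs t] g) :
    ∫⁻ ω, a ω * ENNReal.ofReal ((g ω - x ω) ^ 2) ∂P₁ =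
      ∫⁻ ω, likRatio μ σ2 N₀ (U p t ω) (V y t ω) * (a ω *
        (ENNReal.ofReal ((g ω - postMean μ σ2 N₀ (U p t ω) (V y t ω)) ^ 2)
          + postVar σ2 N₀ (U p t ω))) ∂P₀ := by
  rw [obsHistory_eq_comap] at ha hg
  obtain ⟨a, ha', rfl⟩ := ha.exists_eq_measurable_comp
  obtain ⟨g, hg', rfl⟩ := hg.exists_eq_measurable_comp
  have := hM.lintegral_pairs_alt hσ hN t
    (Φ := fun z => a z.1 * ENNReal.ofReal ((g z.1 - z.2) ^ 2)) (by fun_prop)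
  simp only [Function.comp_apply]
  rw [this]
  refine lintegral_congr fun ω => ?_
  dsimp only
  rw [lintegral_const_mul _ (by fun_prop), lintegral_sq_sub_gaussianReal]

lemma lintegral_obs_alt (hM : IsChannelModel μ σ2 N₀ P₀ P₁ p y x) (hσ : 0 < σ2) (hN : 0 < N₀)
    {t : ℕ} {a : Ω → ℝ≥0∞}
    (ha : Measurable[obsHistory p y hM.measurable_pilot hM.measurable_obs t] a) :
    ∫⁻ ω, a ω ∂P₁ = ∫⁻ ω, likRatio μ σ2 N₀ (U p t ω) (V y t ω) * a ω ∂P₀ := by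
  rw [obsHistory_eq_comap] at ha
  obtain ⟨a, ha', rfl⟩ := ha.exists_eq_measurable_comp
  have := hM.lintegral_pairs_alt hσ hN t (Φ := fun z => a z.1) (by fun_prop)
  simpa using this

/-- Under the null hypothesis, the conditional law of `V_t` given the pilots is `nullLaw U_t`. -/
lemma setLIntegral_null (hM : IsChannelModel μ σ2 N₀ P₀ P₁ p y x) {t : ℕ} {B : Set Ω}
    (hB : MeasurableSet[pilotHistory p hM.measurable_pilot t] B) {φ : ℝ × ℝ → ℝ≥0∞}
    (hφ : Measurable φ) :
    ∫⁻ ω in B, φ (U p t ω, V y t ω) ∂P₀ =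
      ∫⁻ ω in B, ∫⁻ v, φ (U p t ω, v) ∂nullLaw N₀ (U p t ω) ∂P₀ := by
  have hBm := (pilotHistory p hM.measurable_pilot).le t _ hB
  -- The event depends on the pilots only, so its indicator leaves the integral over the noise.
  obtain ⟨B', hB', rfl⟩ := pilotHistory_le_comap _ t _ hB
  have hen := measurable_energy t
  have h1 := hM.lintegral_null t
    (Φ := fun z => (B'.indicator 1 z.1 : ℝ≥0∞) * φ (energy t z.1, ∑ i, z.2 i))
    (by have := (measurable_one (α := ℝ≥0∞)).indicator hB'; fun_prop)
  have hcond : ∀ q, ∫⁻ w, (B'.indicator 1 q : ℝ≥0∞) * φ (energy t q, ∑ i, w i)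
      ∂noiseLawUpTo N₀ t q =
        B'.indicator (fun q => ∫⁻ v, φ (energy t q, v) ∂nullLaw N₀ (energy t q)) q := by
    intro q
    have hq : Measurable fun v => φ (energy t q, v) := by fun_prop
    have h2 : ∫⁻ w, φ (energy t q, ∑ i, w i) ∂noiseLawUpTo N₀ t q =
        ∫⁻ v, φ (energy t q, v) ∂nullLaw N₀ (energy t q) := by
      rw [← map_sum_noiseLawUpTo, lintegral_map hq (by fun_prop)]
    rw [lintegral_const_mul _ (by fun_prop), h2]
    by_cases hqB : q ∈ B' <;> simp [hqB]
  simp only [hcond] at h1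
  have hint : Measurable fun q => ∫⁻ v, φ (energy t q, v) ∂nullLaw N₀ (energy t q) :=
    (measurable_lintegral_nullLaw N₀ hφ).comp hen
  rw [lintegral_map (hint.indicator hB') hM.measurable_pilots] at h1
  rw [← lintegral_indicator hBm, ← lintegral_indicator hBm]
  refine Eq.trans (lintegral_congr fun ω => ?_) (h1.trans (lintegral_congr fun ω => ?_))
  · rw [sum_obsUpTo, energy_pilot]
    by_cases hω : (fun m => p m ω) ∈ B' <;> simp [hω]
  · rfl

end IsChannelModel

/-! ### Pointwise minimization of the cost -/

section RuleCost

variable (μ : ℝ) (σ2 N₀ c₀ c₁ ce : ℝ≥0)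

/-- Cost of the decision `d` and the estimate `e` when `(U, V) = (u, v)`, as a density with respect
to the null hypothesis. -/
noncomputable def ruleCost (u v : ℝ) (d : Fin 2) (e : ℝ) : ℝ≥0∞ :=
  if d = 1 then c₀ + likRatio μ σ2 N₀ u v *
    (ce * (ENNReal.ofReal ((e - postMean μ σ2 N₀ u v) ^ 2) + postVar σ2 N₀ u))
  else likRatio μ σ2 N₀ u v *
    (c₁ + ce * (ENNReal.ofReal (postMean μ σ2 N₀ u v ^ 2) + postVar σ2 N₀ u))

/-- The least value of `ruleCost`. -/
noncomputable def minRuleCost (u v : ℝ) : ℝ≥0∞ :=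
  min (c₀ : ℝ≥0∞) (missCost μ σ2 N₀ c₁ ce u v) + ce * (likRatio μ σ2 N₀ u v * postVar σ2 N₀ u)

lemma measurable_minRuleCost :
    Measurable fun z : ℝ × ℝ => minRuleCost μ σ2 N₀ c₀ c₁ ce z.1 z.2 := by
  unfold minRuleCost
  exact (measurable_const.min (measurable_missCost μ σ2 N₀ c₁ ce)).add
    (((measurable_likRatio μ σ2 N₀).mul
      ((measurable_postVar σ2 N₀).comp measurable_fst).coe_nnreal_ennreal).const_mul _)

lemma measurable_optCost : Measurable (optCost μ σ2 N₀ c₀ c₁ ce) := by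
  unfold optCost
  exact (measurable_lintegral_nullLaw N₀ (measurable_const.min
    (measurable_missCost μ σ2 N₀ c₁ ce))).add
      ((measurable_postVar σ2 N₀).coe_nnreal_ennreal.const_mul _)

variable {μ σ2 N₀ c₀ c₁ ce}

lemma ruleCost_zero (u v e : ℝ) : ruleCost μ σ2 N₀ c₀ c₁ ce u v 0 e =
    missCost μ σ2 N₀ c₁ ce u v + ce * (likRatio μ σ2 N₀ u v * postVar σ2 N₀ u) := by
  rw [ruleCost, if_neg (by decide), missCost]
  ring

lemma minRuleCost_le (u v : ℝ) (d : Fin 2) (e : ℝ) :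
    minRuleCost μ σ2 N₀ c₀ c₁ ce u v ≤ ruleCost μ σ2 N₀ c₀ c₁ ce u v d e := by
  rw [minRuleCost]
  rcases eq_or_ne d 1 with rfl | hd
  · rw [ruleCost, if_pos rfl]
    refine add_le_add (min_le_left _ _) ?_
    rw [mul_left_comm]
    gcongr
    exact le_add_self
  · obtain rfl : d = 0 := by omega
    rw [ruleCost_zero]
    gcongr
    exact min_le_right _ _

/-- The extended logarithm is an order embedding, and the finite likelihood ratio allows clearing
the denominator even if it is 0: then c₀/0 is infinite for c₀ > 0, and 0/0 = 0 agrees with deciding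
1. -/
lemma log_div_le_iff (u v : ℝ) :
    ENNReal.log (c₀ / (c₁ + ce * ENNReal.ofReal (postMean μ σ2 N₀ u v ^ 2))) ≤
        ((logLR μ σ2 N₀ u v : ℝ) : EReal) ↔ (c₀ : ℝ≥0∞) ≤ missCost μ σ2 N₀ c₁ ce u v := by
  have h : ((logLR μ σ2 N₀ u v : ℝ) : EReal) = ENNReal.log (likRatio μ σ2 N₀ u v) := by
    rw [likRatio, ENNReal.log_ofReal_of_pos (Real.exp_pos _), Real.log_exp]
  rw [h, ENNReal.log_le_log_iff, ENNReal.div_le_iff_le_mul (Or.inr (likRatio_ne_top u v)), missCost]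
  exact Or.inl (ENNReal.add_ne_top.2
    ⟨ENNReal.coe_ne_top, ENNReal.mul_ne_top ENNReal.coe_ne_top ENNReal.ofReal_ne_top⟩)

variable {Ω : Type*} {p : ℕ → Ω → ℂ} {y : ℕ → Ω → ℝ}

lemma decision_eq_one_iff (t : ℕ) (ω : Ω) : decision μ σ2 N₀ c₀ c₁ ce p y t ω = 1 ↔
    (c₀ : ℝ≥0∞) ≤ missCost μ σ2 N₀ c₁ ce (U p t ω) (V y t ω) := by
  rw [← log_div_le_iff, decision]
  split_ifs with h
  · exact iff_of_true rfl h
  · exact iff_of_false (by decide) h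

lemma ruleCost_decision (t : ℕ) (ω : Ω) :
    ruleCost μ σ2 N₀ c₀ c₁ ce (U p t ω) (V y t ω) (decision μ σ2 N₀ c₀ c₁ ce p y t ω)
      (estimator μ σ2 N₀ p y t ω) = minRuleCost μ σ2 N₀ c₀ c₁ ce (U p t ω) (V y t ω) := by
  have he : estimator μ σ2 N₀ p y t ω = postMean μ σ2 N₀ (U p t ω) (V y t ω) := rfl
  by_cases h : decision μ σ2 N₀ c₀ c₁ ce p y t ω = 1
  · rw [ruleCost, if_pos h, he, minRuleCost, min_eq_left ((decision_eq_one_iff t ω).1 h)]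
    simp only [sub_self, ne_eq, OfNat.ofNat_ne_zero, not_false_eq_true, zero_pow,
      ENNReal.ofReal_zero, zero_add]
    ring
  · have h0 : decision μ σ2 N₀ c₀ c₁ ce p y t ω = 0 := by omega
    rw [h0, ruleCost_zero, minRuleCost,
      min_eq_right (not_le.1 (mt (decision_eq_one_iff t ω).2 h)).le]

/-- Arranged to match the three terms of `cost`. Deciding 0 counts as estimating the channel by 0,
so the truncated estimate covers both decisions. -/
lemma ruleCost_eq (u v : ℝ) (d : Ω → Fin 2) (xhat : Ω → ℝ) (ω : Ω) :
    ruleCost μ σ2 N₀ c₀ c₁ ce u v (d ω) (xhat ω) =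
      c₀ * {ω' | d ω' = 1}.indicator 1 ω
        + c₁ * (likRatio μ σ2 N₀ u v * {ω' | d ω' = 0}.indicator 1 ω)
        + ce * (likRatio μ σ2 N₀ u v * (ENNReal.ofReal
          (({ω' | d ω' = 1}.indicator xhat ω - postMean μ σ2 N₀ u v) ^ 2) + postVar σ2 N₀ u)) := by
  by_cases hd : d ω = 1
  · have h0 : ω ∉ {ω' | d ω' = 0} := by simp [hd]
    have h1 : ω ∈ {ω' | d ω' = 1} := hd
    rw [ruleCost, if_pos hd, Set.indicator_of_mem h1, Set.indicator_of_mem h1,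
      Set.indicator_of_notMem h0, Pi.one_apply]
    ring
  · have h0 : ω ∈ {ω' | d ω' = 0} := by change d ω = 0; omega
    have h1 : ω ∉ {ω' | d ω' = 1} := hd
    rw [ruleCost, if_neg hd, Set.indicator_of_notMem h1, Set.indicator_of_notMem h1,
      Set.indicator_of_mem h0, Pi.one_apply, zero_sub, neg_sq]
    ring

end RuleCost

/-! ### The cost of a rule on the event τ = t -/

namespace IsChannelModel

variable {Ω : Type*} [mΩ : MeasurableSpace Ω] {p : ℕ → Ω → ℂ} {y : ℕ → Ω → ℝ} {x : Ω → ℝ}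
  {μ : ℝ} {σ2 N₀ c₀ c₁ ce : ℝ≥0} {P₀ P₁ : Measure Ω} [IsProbabilityMeasure P₀]
  [IsProbabilityMeasure P₁] {τ : Ω → WithTop ℕ} {d : Ω → Fin 2} {xhat : Ω → ℝ} {t : ℕ} {B : Set Ω}

lemma setLIntegral_condLExp_of_subset {F : Filtration ℕ mΩ} (hτ : IsStoppingTime F τ)
    (hB : MeasurableSet[F t] B) (hBτ : B ⊆ {ω | τ ω = WithTop.some t}) (P : Measure Ω)
    [IsProbabilityMeasure P] (f : Ω → ℝ≥0∞) :
    ∫⁻ ω in B, condLExp hτ.measurableSpace P f ω ∂P = ∫⁻ ω in B, f ω ∂P := by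
  refine setLIntegral_condLExp hτ.measurableSpace_le P f ?_
  rw [← Set.inter_eq_left.2 hBτ] at hB ⊢
  exact (hτ.measurableSet_inter_eq_iff B t).2 hB

/-- On this event a conditional expectation under `P₁` is a function of the pilots up to t, so it
has the same integral under `P₀`. -/
lemma setLIntegral_condLExp_alt (hM : IsChannelModel μ σ2 N₀ P₀ P₁ p y x)
    (hτ : IsStoppingTime (pilotHistory p hM.measurable_pilot) τ)
    (hB : MeasurableSet[pilotHistory p hM.measurable_pilot t] B)
    (hBτ : B ⊆ {ω | τ ω = WithTop.some t}) (f : Ω → ℝ≥0∞) :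
    ∫⁻ ω in B, condLExp hτ.measurableSpace P₁ f ω ∂P₀ = ∫⁻ ω in B, f ω ∂P₁ := by
  have hBm := (pilotHistory p hM.measurable_pilot).le t _ hB
  rw [← setLIntegral_condLExp_of_subset hτ hB hBτ P₁ f, ← lintegral_indicator hBm,
    ← lintegral_indicator hBm]
  refine hM.lintegral_pilot_eq (t := t) ?_
  rw [← Set.inter_eq_left.2 hBτ, ← Set.indicator_indicator]
  exact (measurable_indicator_eq hτ (measurable_condLExp _ _ _) t).indicator hB

lemma setLIntegral_miss (hM : IsChannelModel μ σ2 N₀ P₀ P₁ p y x) (hσ : 0 < σ2) (hN : 0 < N₀)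
    (hR : IsRule p y hM.measurable_pilot hM.measurable_obs τ d xhat)
    (hB : MeasurableSet[pilotHistory p hM.measurable_pilot t] B)
    (hBτ : B ⊆ {ω | τ ω = WithTop.some t}) :
    ∫⁻ ω in B, {ω' | d ω' = 0}.indicator 1 ω ∂P₁ =
      ∫⁻ ω in B, likRatio μ σ2 N₀ (U p t ω) (V y t ω) * {ω' | d ω' = 0}.indicator 1 ω ∂P₀ := by
  have hτ' := isStoppingTime_obs (hy := hM.measurable_obs) hR.isStopping
  have hBm := (pilotHistory p hM.measurable_pilot).le t _ hB
  have hBo := pilotHistory_le_obsHistory p y hM.measurable_pilot hM.measurable_obs t _ hB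
  have hdm : MeasurableSet[hτ'.measurableSpace] {ω | d ω = 0} :=
    hR.decision (measurableSet_singleton 0)
  have ha : Measurable[obsHistory p y hM.measurable_pilot hM.measurable_obs t]
      (B.indicator ({ω' | d ω' = 0}.indicator (1 : Ω → ℝ≥0∞))) := by
    rw [← Set.inter_eq_left.2 hBτ, ← Set.indicator_indicator]
    exact (measurable_indicator_eq hτ' (Measurable.indicator
      (@measurable_const ℝ≥0∞ Ω _ hτ'.measurableSpace 1) hdm) t).indicator hBo
  rw [← lintegral_indicator hBm, ← lintegral_indicator hBm]
  refine (hM.lintegral_obs_alt hσ hN ha).trans (lintegral_congr fun ω => ?_)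
  by_cases hω : ω ∈ B <;> simp [hω]

lemma setLIntegral_estimation (hM : IsChannelModel μ σ2 N₀ P₀ P₁ p y x) (hσ : 0 < σ2) (hN : 0 < N₀)
    (hR : IsRule p y hM.measurable_pilot hM.measurable_obs τ d xhat)
    (hB : MeasurableSet[pilotHistory p hM.measurable_pilot t] B)
    (hBτ : B ⊆ {ω | τ ω = WithTop.some t}) :
    ∫⁻ ω in B, ({ω' | d ω' = 1}.indicator (fun ω' => ENNReal.ofReal ((xhat ω' - x ω') ^ 2)) ω
        + {ω' | d ω' = 0}.indicator (fun ω' => ENNReal.ofReal (x ω' ^ 2)) ω) ∂P₁ =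
      ∫⁻ ω in B, likRatio μ σ2 N₀ (U p t ω) (V y t ω) * (ENNReal.ofReal
        (({ω' | d ω' = 1}.indicator xhat ω - postMean μ σ2 N₀ (U p t ω) (V y t ω)) ^ 2)
          + postVar σ2 N₀ (U p t ω)) ∂P₀ := by
  have hτ' := isStoppingTime_obs (hy := hM.measurable_obs) hR.isStopping
  have hBm := (pilotHistory p hM.measurable_pilot).le t _ hB
  have hBo := pilotHistory_le_obsHistory p y hM.measurable_pilot hM.measurable_obs t _ hB
  have hdm : MeasurableSet[hτ'.measurableSpace] {ω | d ω = 1} :=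
    hR.decision (measurableSet_singleton 1)
  have ha : Measurable[obsHistory p y hM.measurable_pilot hM.measurable_obs t]
      (B.indicator (1 : Ω → ℝ≥0∞)) := Measurable.indicator (@measurable_const ℝ≥0∞ Ω _
        (obsHistory p y hM.measurable_pilot hM.measurable_obs t) 1) hBo
  have hg := measurable_indicator_eq hτ' (Measurable.indicator hR.estimate hdm) t
  have := hM.lintegral_sq_alt hσ hN ha hg
  rw [← lintegral_indicator hBm, ← lintegral_indicator hBm]
  refine Eq.trans (lintegral_congr fun ω => ?_) (this.trans (lintegral_congr fun ω => ?_))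
  · by_cases hω : ω ∈ B
    · have hω' : τ ω = WithTop.some t := hBτ hω
      by_cases hd : d ω = 1
      · simp [hω, hω', hd]
      · have hd0 : d ω = 0 := by omega
        simp [hω, hω', hd0]
    · simp [hω]
  · by_cases hω : ω ∈ B
    · have hω' : τ ω = WithTop.some t := hBτ hω
      simp [hω, hω']
    · simp [hω]

/-- On the event that the rule stops at time `t`, the conditional cost is the conditional
expectation of `ruleCost`. -/
lemma setLIntegral_cost (hM : IsChannelModel μ σ2 N₀ P₀ P₁ p y x) (hσ : 0 < σ2) (hN : 0 < N₀)
    (hR : IsRule p y hM.measurable_pilot hM.measurable_obs τ d xhat)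
    (hB : MeasurableSet[pilotHistory p hM.measurable_pilot t] B)
    (hBτ : B ⊆ {ω | τ ω = WithTop.some t}) :
    ∫⁻ ω in B, cost c₀ c₁ ce P₀ P₁ x hR.isStopping.measurableSpace d xhat ω ∂P₀ =
      ∫⁻ ω in B, ruleCost μ σ2 N₀ c₀ c₁ ce (U p t ω) (V y t ω) (d ω) (xhat ω) ∂P₀ := by
  have hτ := hR.isStopping
  have hle' := (isStoppingTime_obs (hy := hM.measurable_obs) hτ).measurableSpace_le
  have hle := (obsHistory p y hM.measurable_pilot hM.measurable_obs).le t
  have hdm : ∀ i : Fin 2, MeasurableSet {ω | d ω = i} := fun i =>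
    hle' _ (hR.decision (measurableSet_singleton i))
  have hUV := (measurable_UV hM.measurable_pilot hM.measurable_obs t).mono hle le_rfl
  have hU : Measurable (U p t) := measurable_fst.comp hUV
  have hV : Measurable (V y t) := measurable_snd.comp hUV
  have hE : Measurable fun ω => likRatio μ σ2 N₀ (U p t ω) (V y t ω) := by
    unfold likRatio logLR; fun_prop
  have hm1 : Measurable fun ω => ({ω' | d ω' = 1}.indicator 1 ω : ℝ≥0∞) :=
    measurable_one.indicator (hdm 1)
  have hm0 : Measurable fun ω => ({ω' | d ω' = 0}.indicator 1 ω : ℝ≥0∞) :=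
    measurable_one.indicator (hdm 0)
  have hlik : Measurable fun ω => likRatio μ σ2 N₀ (U p t ω) (V y t ω) *
      {ω' | d ω' = 0}.indicator 1 ω := hE.mul hm0
  have hxm : Measurable xhat := hR.estimate.mono hle' le_rfl
  have hxi : Measurable ({ω' | d ω' = 1}.indicator xhat) := hxm.indicator (hdm 1)
  have hpm : Measurable fun ω => postMean μ σ2 N₀ (U p t ω) (V y t ω) := by
    unfold postMean; fun_prop
  have hpv : Measurable fun ω => postVar σ2 N₀ (U p t ω) := (measurable_postVar σ2 N₀).comp hU
  have hest : Measurable fun ω => likRatio μ σ2 N₀ (U p t ω) (V y t ω) * (ENNReal.ofReal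
        (({ω' | d ω' = 1}.indicator xhat ω - postMean μ σ2 N₀ (U p t ω) (V y t ω)) ^ 2)
          + postVar σ2 N₀ (U p t ω)) :=
    hE.mul (((hxi.sub hpm).pow_const 2).ennreal_ofReal.add hpv.coe_nnreal_ennreal)
  simp_rw [ruleCost_eq]
  unfold cost
  rw [lintegral_add_right _ ((measurable_condLExp' _ _ _).const_mul _),
    lintegral_add_right _ ((measurable_condLExp' _ _ _).const_mul _),
    lintegral_const_mul _ (measurable_condLExp' _ _ _),
    lintegral_const_mul _ (measurable_condLExp' _ _ _),
    lintegral_const_mul _ (measurable_condLExp' _ _ _),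
    setLIntegral_condLExp_of_subset hτ hB hBτ,
    hM.setLIntegral_condLExp_alt hτ hB hBτ, hM.setLIntegral_condLExp_alt hτ hB hBτ,
    hM.setLIntegral_miss hσ hN hR hB hBτ, hM.setLIntegral_estimation hσ hN hR hB hBτ,
    lintegral_add_right _ (hest.const_mul _), lintegral_add_right _ (hlik.const_mul _),
    lintegral_const_mul _ hm1, lintegral_const_mul _ hlik, lintegral_const_mul _ hest]

lemma setLIntegral_optCost (hM : IsChannelModel μ σ2 N₀ P₀ P₁ p y x) (hσ : 0 < σ2) (hN : 0 < N₀)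
    (hB : MeasurableSet[pilotHistory p hM.measurable_pilot t] B) :
    ∫⁻ ω in B, optCost μ σ2 N₀ c₀ c₁ ce (U p t ω) ∂P₀ =
      ∫⁻ ω in B, minRuleCost μ σ2 N₀ c₀ c₁ ce (U p t ω) (V y t ω) ∂P₀ := by
  have h := hM.setLIntegral_null hB (measurable_minRuleCost μ σ2 N₀ c₀ c₁ ce)
  rw [h]
  refine lintegral_congr fun ω => ?_
  rw [optCost_eq_lintegral hσ hN (U_nonneg t ω)]
  rfl

lemma measurable_cost_indicator (hM : IsChannelModel μ σ2 N₀ P₀ P₁ p y x)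
    (hτ : IsStoppingTime (pilotHistory p hM.measurable_pilot) τ) (t : ℕ) :
    Measurable[pilotHistory p hM.measurable_pilot t] ({ω | τ ω = WithTop.some t}.indicator
      (cost c₀ c₁ ce P₀ P₁ x hτ.measurableSpace d xhat)) := by
  refine measurable_indicator_eq hτ ?_ t
  unfold cost
  exact (((measurable_condLExp _ _ _).const_mul _).add
    ((measurable_condLExp _ _ _).const_mul _)).add ((measurable_condLExp _ _ _).const_mul _)

end IsChannelModel

/-! ### The energy threshold stopping time -/

section HittingTime

variable {Ω : Type*} {p : ℕ → Ω → ℂ} {γ : ℝ}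

lemma isStoppingTime_stopAt [MeasurableSpace Ω] (hp : ∀ m, Measurable (p m)) (γ : ℝ) :
    IsStoppingTime (pilotHistory p hp) (stopAt p γ) :=
  Adapted.isStoppingTime_hittingAfter (fun t => measurable_U hp t) measurableSet_Ici

lemma one_le_stopAt (ω : Ω) : 1 ≤ stopAt p γ ω := le_hittingAfter (n := 1) ω

lemma le_U_of_stopAt_eq {t : ℕ} {ω : Ω} (h : stopAt p γ ω = WithTop.some t) : γ ≤ U p t ω := by
  have hne : hittingAfter (U p) (Set.Ici γ) 1 ω ≠ ⊤ := by
    change stopAt p γ ω ≠ ⊤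
    rw [h]
    exact WithTop.coe_ne_top
  have := hittingAfter_mem_set_of_ne_top hne
  have h2 : hittingAfter (U p) (Set.Ici γ) 1 ω = WithTop.some t := h
  rw [h2] at this
  exact this

lemma stopAt_le {t : ℕ} {ω : Ω} (ht : 1 ≤ t) (h : γ ≤ U p t ω) : stopAt p γ ω ≤ WithTop.some t :=
  hittingAfter_le_of_mem ht h

end HittingTime

/-! ### The proposed triplet is a rule -/

section Measurability

variable {Ω : Type*} [mΩ : MeasurableSpace Ω] {p : ℕ → Ω → ℂ} {y : ℕ → Ω → ℝ}

lemma measurable_estimator (μ : ℝ) (σ2 N₀ : ℝ≥0) (hp : ∀ m, Measurable (p m))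
    (hy : ∀ m, Measurable (y m)) (t : ℕ) :
    Measurable[obsHistory p y hp hy t] (estimator μ σ2 N₀ p y t) :=
  Measurable.comp (g := fun z : ℝ × ℝ => postMean μ σ2 N₀ z.1 z.2)
    (measurable_postMean μ σ2 N₀) (measurable_UV hp hy t)

lemma measurable_decision (μ : ℝ) (σ2 N₀ c₀ c₁ ce : ℝ≥0) (hp : ∀ m, Measurable (p m))
    (hy : ∀ m, Measurable (y m)) (t : ℕ) :
    Measurable[obsHistory p y hp hy t] (decision μ σ2 N₀ c₀ c₁ ce p y t) := by
  classical
  have hset : MeasurableSet {z : ℝ × ℝ | (c₀ : ℝ≥0∞) ≤ missCost μ σ2 N₀ c₁ ce z.1 z.2} :=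
    measurableSet_le measurable_const (measurable_missCost μ σ2 N₀ c₁ ce)
  have hind : Measurable fun z : ℝ × ℝ =>
      if (c₀ : ℝ≥0∞) ≤ missCost μ σ2 N₀ c₁ ce z.1 z.2 then (1 : Fin 2) else 0 :=
    Measurable.ite hset measurable_const measurable_const
  have heq : decision μ σ2 N₀ c₀ c₁ ce p y t =
      (fun z : ℝ × ℝ => if (c₀ : ℝ≥0∞) ≤ missCost μ σ2 N₀ c₁ ce z.1 z.2 then (1 : Fin 2) else 0) ∘
        fun ω => (U p t ω, V y t ω) := by
    ext ω
    have := decision_eq_one_iff (μ := μ) (σ2 := σ2) (N₀ := N₀) (c₀ := c₀) (c₁ := c₁) (ce := ce)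
      (p := p) (y := y) t ω
    simp only [Function.comp_apply]
    split_ifs with h
    · rw [this.2 h]
    · have := mt this.1 h
      congr 1
      omega
  rw [heq]
  exact hind.comp (measurable_UV hp hy t)

/-- The likelihood ratio test and the posterior mean form a rule, for every stopping time. -/
lemma isRule_decision_estimator (μ : ℝ) (σ2 N₀ c₀ c₁ ce : ℝ≥0) {hp : ∀ m, Measurable (p m)}
    {hy : ∀ m, Measurable (y m)} {τ : Ω → WithTop ℕ} (hτ : IsStoppingTime (pilotHistory p hp) τ)
    (h1 : ∀ ω, 1 ≤ τ ω) :
    IsRule p y hp hy τ (stoppedValue (decision μ σ2 N₀ c₀ c₁ ce p y) τ)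
      (stoppedValue (estimator μ σ2 N₀ p y) τ) where
  isStopping := hτ
  pos := h1
  decision := measurable_stoppedValue_of_adapted (isStoppingTime_obs hτ)
    (measurable_decision μ σ2 N₀ c₀ c₁ ce hp hy)
  estimate := measurable_stoppedValue_of_adapted (isStoppingTime_obs hτ)
    (measurable_estimator μ σ2 N₀ hp hy)

end Measurability

/-! ### The posterior kernel -/

section Posterior

variable {Ω : Type*} {p : ℕ → Ω → ℂ} {y : ℕ → Ω → ℝ} {μ : ℝ} {σ2 N₀ : ℝ≥0}

/-- Posterior law of the channel coefficient as a function of pilots and observations. -/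
noncomputable def posterior (μ : ℝ) (σ2 N₀ : ℝ≥0) (t : ℕ) :
    Kernel (Finset.range t → ℝ × ℂ) ℝ where
  toFun z := gaussianReal (postMean μ σ2 N₀ (∑ i, ‖(z i).2‖ ^ 2) (∑ i, (z i).1))
    (postVar σ2 N₀ (∑ i, ‖(z i).2‖ ^ 2))
  measurable' := by
    have h1 : Measurable fun z : Finset.range t → ℝ × ℂ =>
        postMean μ σ2 N₀ (∑ i, ‖(z i).2‖ ^ 2) (∑ i, (z i).1) := by
      unfold postMean; fun_prop
    have h2 : Measurable fun z : Finset.range t → ℝ × ℂ =>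
        postVar σ2 N₀ (∑ i, ‖(z i).2‖ ^ 2) := by
      unfold postVar; fun_prop
    exact measurable_gaussianReal.comp (h1.prodMk h2)

instance (t : ℕ) : IsMarkovKernel (posterior μ σ2 N₀ t) :=
  ⟨fun _ => inferInstanceAs (IsProbabilityMeasure (gaussianReal _ _))⟩

lemma posterior_pairsUpTo (t : ℕ) (ω : Ω) : posterior μ σ2 N₀ t (pairsUpTo p y t ω) =
    gaussianReal (postMean μ σ2 N₀ (U p t ω) (V y t ω)) (postVar σ2 N₀ (U p t ω)) := by
  have hU : ∑ i, ‖(pairsUpTo p y t ω i).2‖ ^ 2 = U p t ω :=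
    Finset.sum_coe_sort (Finset.range t) fun i => ‖p i ω‖ ^ 2
  have hV : ∑ i, (pairsUpTo p y t ω i).1 = V y t ω :=
    Finset.sum_coe_sort (Finset.range t) fun i => y i ω
  change gaussianReal _ _ = _
  rw [hU, hV]

end Posterior

/-! ### Optimal cost, posterior mean and likelihood ratio -/

namespace IsChannelModel

variable {Ω : Type*} [mΩ : MeasurableSpace Ω] {p : ℕ → Ω → ℂ} {y : ℕ → Ω → ℝ} {x : Ω → ℝ}
  {μ : ℝ} {σ2 N₀ c₀ c₁ ce : ℝ≥0} {P₀ P₁ : Measure Ω} [IsProbabilityMeasure P₀]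
  [IsProbabilityMeasure P₁] {τ : Ω → WithTop ℕ} {d : Ω → Fin 2} {xhat : Ω → ℝ}

lemma measurable_optCost_indicator (hM : IsChannelModel μ σ2 N₀ P₀ P₁ p y x)
    (hτ : IsStoppingTime (pilotHistory p hM.measurable_pilot) τ) (t : ℕ) :
    Measurable[pilotHistory p hM.measurable_pilot t] ({ω | τ ω = WithTop.some t}.indicator
      fun ω => optCost μ σ2 N₀ c₀ c₁ ce (U p t ω)) :=
  Measurable.indicator ((measurable_optCost μ σ2 N₀ c₀ c₁ ce).comp
    (measurable_U hM.measurable_pilot t)) (hτ.measurableSet_eq t)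

/-- The cost of a rule is at least the optimal cost for the pilot energy spent. -/
lemma optCost_le_cost (hM : IsChannelModel μ σ2 N₀ P₀ P₁ p y x) (hσ : 0 < σ2) (hN : 0 < N₀)
    (hR : IsRule p y hM.measurable_pilot hM.measurable_obs τ d xhat) :
    ∀ᵐ ω ∂(P₀ + P₁), ∀ t : ℕ, τ ω = WithTop.some t → optCost μ σ2 N₀ c₀ c₁ ce (U p t ω) ≤
      cost c₀ c₁ ce P₀ P₁ x hR.isStopping.measurableSpace d xhat ω := by
  rw [ae_all_iff]
  intro t
  refine hM.ae_le_of_forall_setLIntegral_le (A := {ω | τ ω = WithTop.some t})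
    (hR.isStopping.measurableSet_eq t) (hM.measurable_optCost_indicator hR.isStopping t)
    (hM.measurable_cost_indicator hR.isStopping t) fun B hB hBτ => ?_
  rw [hM.setLIntegral_cost hσ hN hR hB hBτ, hM.setLIntegral_optCost hσ hN hB]
  exact lintegral_mono fun ω => minRuleCost_le _ _ _ _

/-- The likelihood ratio test and the posterior mean attain the optimal cost. -/
lemma cost_le_optCost (hM : IsChannelModel μ σ2 N₀ P₀ P₁ p y x) (hσ : 0 < σ2) (hN : 0 < N₀)
    (hτ : IsStoppingTime (pilotHistory p hM.measurable_pilot) τ) (h1 : ∀ ω, 1 ≤ τ ω) :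
    ∀ᵐ ω ∂(P₀ + P₁), ∀ t : ℕ, τ ω = WithTop.some t →
      cost c₀ c₁ ce P₀ P₁ x hτ.measurableSpace (stoppedValue (decision μ σ2 N₀ c₀ c₁ ce p y) τ)
        (stoppedValue (estimator μ σ2 N₀ p y) τ) ω ≤ optCost μ σ2 N₀ c₀ c₁ ce (U p t ω) := by
  have hR := isRule_decision_estimator (hy := hM.measurable_obs) μ σ2 N₀ c₀ c₁ ce hτ h1
  rw [ae_all_iff]
  intro t
  refine hM.ae_le_of_forall_setLIntegral_le (A := {ω | τ ω = WithTop.some t})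
    (hτ.measurableSet_eq t) (hM.measurable_cost_indicator hτ t)
    (hM.measurable_optCost_indicator hτ t) fun B hB hBτ => ?_
  have hBm := (pilotHistory p hM.measurable_pilot).le t _ hB
  rw [hM.setLIntegral_cost hσ hN hR hB hBτ, hM.setLIntegral_optCost hσ hN hB]
  refine (setLIntegral_congr_fun hBm fun ω hω => ?_).le
  have hω' : τ ω = WithTop.some t := hBτ hω
  -- On this event the stopped values are those at time t, which attain the pointwise minimum.
  rw [← ruleCost_decision t ω, stoppedValue, stoppedValue, hω']
  rfl

lemma map_pairs_channel (hM : IsChannelModel μ σ2 N₀ P₀ P₁ p y x) (hσ : 0 < σ2) (hN : 0 < N₀)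
    (t : ℕ) : P₁.map (fun ω => (pairsUpTo p y t ω, x ω)) =
      P₁.map (pairsUpTo p y t) ⊗ₘ posterior μ σ2 N₀ t := by
  have hX : Measurable (pairsUpTo p y t) :=
    measurable_pi_lambda _ fun i => (hM.measurable_obs i).prodMk (hM.measurable_pilot i)
  refine Measure.ext_of_lintegral _ fun Φ hΦ => ?_
  have hint : Measurable fun z => ∫⁻ s, Φ (z, s) ∂posterior μ σ2 N₀ t z :=
    hΦ.lintegral_kernel_prod_right'
  rw [lintegral_map hΦ (hX.prodMk hM.measurable_channel), Measure.lintegral_compProd hΦ,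
    lintegral_map hint hX, hM.lintegral_pairs_alt hσ hN t hΦ]
  -- A second change of measure, now for a function free of the channel: its posterior average is
  -- itself, so both sides become the same `P₀`-integral.
  have h2 := hM.lintegral_pairs_alt hσ hN t
    (Φ := fun z => ∫⁻ s, Φ (z.1, s) ∂posterior μ σ2 N₀ t z.1) (hint.comp measurable_fst)
  rw [h2]
  simp only [lintegral_const, measure_univ, mul_one, posterior_pairsUpTo]

/-- The estimator is the posterior mean. -/
lemma condExp_channel (hM : IsChannelModel μ σ2 N₀ P₀ P₁ p y x) (hσ : 0 < σ2) (hN : 0 < N₀)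
    (t : ℕ) : P₁[x | obsHistory p y hM.measurable_pilot hM.measurable_obs t]
      =ᵐ[P₁] estimator μ σ2 N₀ p y t := by
  have hX : Measurable (pairsUpTo p y t) :=
    measurable_pi_lambda _ fun i => (hM.measurable_obs i).prodMk (hM.measurable_pilot i)
  have hint : Integrable x P₁ := by
    have h : Integrable id (P₁.map x) := by
      rw [hM.channel_law]
      exact (memLp_id_gaussianReal 1).integrable le_rfl
    exact (integrable_map_measure aestronglyMeasurable_id hM.measurable_channel.aemeasurable).1 h
  rw [obsHistory_eq_comap]
  have h1 := condExp_ae_eq_integral_condDistrib' hX hint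
  have h2 := ae_of_ae_map hX.aemeasurable (condDistrib_ae_eq_of_measure_eq_compProd _
    hM.measurable_channel.aemeasurable (hM.map_pairs_channel hσ hN t))
  filter_upwards [h1, h2] with ω hω1 hω2
  rw [hω1, hω2, posterior_pairsUpTo, integral_id_gaussianReal]
  rfl

/-- `L_t` is the conditional log-likelihood ratio given the pilots. -/
lemma condLExp_alt_eq (hM : IsChannelModel μ σ2 N₀ P₀ P₁ p y x) (hσ : 0 < σ2) (hN : 0 < N₀)
    {t : ℕ} {A : Set Ω}
    (hA : MeasurableSet[obsHistory p y hM.measurable_pilot hM.measurable_obs t] A) :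
    condLExp (pilotHistory p hM.measurable_pilot t) P₁ (A.indicator 1)
      =ᵐ[P₀ + P₁] condLExp (pilotHistory p hM.measurable_pilot t) P₀
        (A.indicator fun ω => ENNReal.ofReal (Real.exp (llr μ σ2 N₀ p y t ω))) := by
  have hle := (pilotHistory p hM.measurable_pilot).le t
  -- Both conditional expectations are functions of the pilots, so equal integrals over pilot events
  -- identify them.
  have key : ∀ B, MeasurableSet[pilotHistory p hM.measurable_pilot t] B →
      ∫⁻ ω in B, condLExp (pilotHistory p hM.measurable_pilot t) P₁ (A.indicator 1) ω ∂P₀ =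
      ∫⁻ ω in B, condLExp (pilotHistory p hM.measurable_pilot t) P₀
        (A.indicator fun ω => ENNReal.ofReal (Real.exp (llr μ σ2 N₀ p y t ω))) ω ∂P₀ := by
    intro B hB
    have hBo := pilotHistory_le_obsHistory p y hM.measurable_pilot hM.measurable_obs t _ hB
    have hBm := hle _ hB
    have ha : Measurable[obsHistory p y hM.measurable_pilot hM.measurable_obs t]
        (B.indicator (A.indicator (1 : Ω → ℝ≥0∞))) :=
      Measurable.indicator (Measurable.indicator (@measurable_const ℝ≥0∞ Ω _
        (obsHistory p y hM.measurable_pilot hM.measurable_obs t) 1) hA) hBo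
    have h1 := setLIntegral_condLExp hle P₁ (A.indicator 1) hB
    rw [setLIntegral_condLExp hle P₀ _ hB]
    rw [← lintegral_indicator hBm, ← lintegral_indicator hBm] at h1 ⊢
    rw [hM.lintegral_pilot_eq (Measurable.indicator (measurable_condLExp _ _ _) hB), h1,
      hM.lintegral_obs_alt hσ hN ha]
    refine lintegral_congr fun ω => ?_
    by_cases hωB : ω ∈ B <;> by_cases hωA : ω ∈ A <;> simp [hωA, hωB]
    rfl
  have hm (P : Measure Ω) (f : Ω → ℝ≥0∞) : Measurable[pilotHistory p hM.measurable_pilot t]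
      (Set.univ.indicator (condLExp (pilotHistory p hM.measurable_pilot t) P f)) := by
    rw [Set.indicator_univ]
    exact measurable_condLExp _ _ _
  filter_upwards [hM.ae_le_of_forall_setLIntegral_le .univ (hm _ _) (hm _ _)
      fun B hB _ => (key B hB).le,
    hM.ae_le_of_forall_setLIntegral_le .univ (hm _ _) (hm _ _)
      fun B hB _ => (key B hB).ge] with ω h1 h2
  exact le_antisymm (h1 trivial) (h2 trivial)

end IsChannelModel

/-! ### Conditional Fisher information -/

section Fisher

variable {N₀ : ℝ≥0}

lemma hasDerivAt_log_gaussianPDFReal (hN : 0 < N₀) (q : ℂ) (z s : ℝ) :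
    HasDerivAt (fun s => Real.log (gaussianPDFReal (s * ‖q‖ ^ 2) (‖q‖₊ ^ 2 * (N₀ / 2)) z))
      (if q = 0 then 0 else 2 / N₀ * (z - s * ‖q‖ ^ 2)) s := by
  have h2 : (0 : ℝ) < N₀ := hN
  split_ifs with hq
  · simp only [hq, nnnorm_zero, ne_eq, OfNat.ofNat_ne_zero, not_false_eq_true, zero_pow, zero_mul,
      gaussianPDFReal_zero_var, Pi.zero_apply, Real.log_zero]
    exact hasDerivAt_const _ _
  have hq' : 0 < ‖q‖ := norm_pos_iff.2 hq
  have hlog : ∀ s : ℝ, Real.log (gaussianPDFReal (s * ‖q‖ ^ 2) (‖q‖₊ ^ 2 * (N₀ / 2)) z) =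
      Real.log (√(2 * Real.pi * (‖q‖ ^ 2 * (N₀ / 2))))⁻¹ +
        -(z - s * ‖q‖ ^ 2) ^ 2 / (2 * (‖q‖ ^ 2 * (N₀ / 2))) := by
    intro s
    rw [gaussianPDFReal, Real.log_mul _ (Real.exp_pos _).ne', Real.log_exp]
    · push_cast; rfl
    · push_cast; positivity
  simp_rw [hlog]
  have h := (((((hasDerivAt_id s).mul_const (‖q‖ ^ 2)).const_sub z).pow 2).neg.div_const
    (2 * (‖q‖ ^ 2 * (N₀ / 2)))).const_add (Real.log (√(2 * Real.pi * (‖q‖ ^ 2 * (N₀ / 2))))⁻¹)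
  refine h.congr_deriv ?_
  simp only [id]
  field_simp
  push_cast
  ring

/-- The conditional Fisher information is proportional to the pilot energy. -/
lemma condFisherInfo_eq (hN : 0 < N₀) (q : ℕ → ℂ) (t : ℕ) (s : ℝ) :
    condFisherInfo N₀ q t s = 2 / N₀ * energy t q := by
  have h2 : (0 : ℝ) < N₀ := hN
  set ν := Measure.pi fun m : Fin t => gaussianReal (s * ‖q m‖ ^ 2) (‖q m‖₊ ^ 2 * (N₀ / 2)) with hν
  have hen : ∑ m : Fin t, ‖q m‖ ^ 2 = energy t q := Fin.sum_univ_eq_sum_range (fun m => ‖q m‖ ^ 2) t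
  -- A vanishing pilot gives the observation 0 almost surely, so its missing score term may be put
  -- back. The score is then 2/N₀ times the centred sum of the observations, whose variance is
  -- energy times N₀/2.
  have hzero : ∀ᵐ z ∂ν, ∀ m : Fin t, q m = 0 → z m - s * ‖q m‖ ^ 2 = 0 := by
    rw [ae_all_iff]
    intro m
    by_cases hm : q m = 0
    · have := (measurePreserving_eval (fun m : Fin t => gaussianReal (s * ‖q m‖ ^ 2)
        (‖q m‖₊ ^ 2 * (N₀ / 2))) m).quasiMeasurePreserving.ae
        (p := fun w => w - s * ‖q m‖ ^ 2 = 0) (by simp [hm])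
      filter_upwards [this] with z hz _ using hz
    · simp [hm]
  have hscore : ∀ᵐ z ∂ν, deriv (logDensity N₀ q t z) s ^ 2 =
      (2 / N₀ * (∑ m, z m - s * energy t q)) ^ 2 := by
    filter_upwards [hzero] with z hz
    have hd : HasDerivAt (logDensity N₀ q t z)
        (∑ m : Fin t, if q m = 0 then 0 else 2 / N₀ * (z m - s * ‖q m‖ ^ 2)) s :=
      HasDerivAt.fun_sum fun m _ => hasDerivAt_log_gaussianPDFReal hN (q m) (z m) s
    rw [hd.deriv, ← hen, Finset.mul_sum, ← Finset.sum_sub_distrib, Finset.mul_sum]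
    congr 1
    refine Finset.sum_congr rfl fun m _ => ?_
    split_ifs with hm
    · rw [hz m hm, mul_zero]
    · rfl
  have hlaw : ν.map (fun z => ∑ m, z m) =
      gaussianReal (s * energy t q) ((energy t q).toNNReal * (N₀ / 2)) := by
    rw [hν, map_sum_pi_gaussianReal, ← Finset.mul_sum, ← Finset.sum_mul, hen]
    congr 2
    ext
    rw [Real.coe_toNNReal _ (energy_nonneg t q), ← hen]
    simp
  have hvar := variance_fun_id_gaussianReal (μ := s * energy t q)
    (v := (energy t q).toNNReal * (N₀ / 2))
  rw [variance_eq_integral measurable_id'.aemeasurable, integral_id_gaussianReal, ← hlaw,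
    integral_map (by fun_prop) (by fun_prop)] at hvar
  rw [condFisherInfo, ← hν, integral_congr_ae hscore]
  simp_rw [mul_pow]
  rw [integral_const_mul, hvar]
  push_cast
  rw [Real.coe_toNNReal _ (energy_nonneg t q)]
  field_simp

end Fisher

end SJDE

/-! ### Assembly of the theorem -/

theorem theorem1 (μ : ℝ) (σ2 N₀ c₀ c₁ ce α : ℝ≥0) (hσ : 0 < σ2) (hN : 0 < N₀) (hα : 0 < α) :
    ∃ γ : ℝ, ∀ (Ω : Type*) [MeasurableSpace Ω] (P₀ P₁ : Measure Ω) [IsProbabilityMeasure P₀]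
      [IsProbabilityMeasure P₁] (p : ℕ → Ω → ℂ) (y : ℕ → Ω → ℝ) (x : Ω → ℝ)
      (hM : SJDE.IsChannelModel μ σ2 N₀ P₀ P₁ p y x),
      -- the triplet is feasible
      SJDE.IsFeasible c₀ c₁ ce α P₀ P₁ p y x hM.measurable_pilot hM.measurable_obs
        (SJDE.stopAt p γ)
        (stoppedValue (SJDE.decision μ σ2 N₀ c₀ c₁ ce p y) (SJDE.stopAt p γ))
        (stoppedValue (SJDE.estimator μ σ2 N₀ p y) (SJDE.stopAt p γ)) ∧
      -- no feasible rule ever stops earlier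
      (∀ (τ : Ω → WithTop ℕ) (d : Ω → Fin 2) (xhat : Ω → ℝ),
        SJDE.IsFeasible c₀ c₁ ce α P₀ P₁ p y x hM.measurable_pilot hM.measurable_obs τ d xhat →
        ∀ᵐ ω ∂(P₀ + P₁), SJDE.stopAt p γ ω ≤ τ ω) ∧
      -- for every stopping time, the decision function and the estimator minimize the cost
      (∀ (τ : Ω → WithTop ℕ) (d : Ω → Fin 2) (xhat : Ω → ℝ)
        (hR : SJDE.IsRule p y hM.measurable_pilot hM.measurable_obs τ d xhat),
        SJDE.IsRule p y hM.measurable_pilot hM.measurable_obs τ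
          (stoppedValue (SJDE.decision μ σ2 N₀ c₀ c₁ ce p y) τ)
          (stoppedValue (SJDE.estimator μ σ2 N₀ p y) τ) ∧
        ∀ᵐ ω ∂(P₀ + P₁), τ ω ≠ ⊤ →
          SJDE.cost c₀ c₁ ce P₀ P₁ x hR.isStopping.measurableSpace
              (stoppedValue (SJDE.decision μ σ2 N₀ c₀ c₁ ce p y) τ)
              (stoppedValue (SJDE.estimator μ σ2 N₀ p y) τ) ω
            ≤ SJDE.cost c₀ c₁ ce P₀ P₁ x hR.isStopping.measurableSpace d xhat ω) ∧
      -- the stopping time is finite if the pilot energy is infinite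
      ((∀ᵐ ω ∂(P₀ + P₁), Filter.Tendsto (fun t => SJDE.U p t ω) Filter.atTop Filter.atTop) →
        ∀ᵐ ω ∂(P₀ + P₁), SJDE.stopAt p γ ω ≠ ⊤) ∧
      -- the estimator is the posterior mean
      (∀ t, P₁[x | SJDE.obsHistory p y hM.measurable_pilot hM.measurable_obs t]
        =ᵐ[P₁] SJDE.estimator μ σ2 N₀ p y t) ∧
      -- `L_t` is the conditional log-likelihood ratio given the pilot history
      (∀ (t : ℕ) (A : Set Ω),
        MeasurableSet[SJDE.obsHistory p y hM.measurable_pilot hM.measurable_obs t] A →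
        condLExp (SJDE.pilotHistory p hM.measurable_pilot t) P₁ (A.indicator 1)
          =ᵐ[P₀ + P₁] condLExp (SJDE.pilotHistory p hM.measurable_pilot t) P₀
            (A.indicator fun ω => ENNReal.ofReal (Real.exp (SJDE.llr μ σ2 N₀ p y t ω)))) ∧
      -- `U_t` is, up to the constant factor `2 / N₀`, the conditional Fisher information
      (∀ (t : ℕ) (ω : Ω) (s : ℝ),
        SJDE.condFisherInfo N₀ (fun m => p m ω) t s = 2 / N₀ * SJDE.U p t ω) := by
  obtain ⟨γ, hγ⟩ := SJDE.exists_energy_threshold μ c₀ c₁ ce hσ hN hα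
  refine ⟨γ, fun Ω _ P₀ P₁ _ _ p y x hM => ?_⟩
  have hτ := SJDE.isStoppingTime_stopAt hM.measurable_pilot γ
  have hcoe : ∀ {z : WithTop ℕ}, z ≠ ⊤ → ∃ t : ℕ, z = WithTop.some t := fun {z} hz =>
    ⟨z.untop hz, (WithTop.coe_untop z hz).symm⟩
  refine ⟨⟨SJDE.isRule_decision_estimator μ σ2 N₀ c₀ c₁ ce hτ SJDE.one_le_stopAt, ?_⟩,
    fun τ d xhat hF => ?_, fun τ d xhat hR =>
      ⟨SJDE.isRule_decision_estimator μ σ2 N₀ c₀ c₁ ce hR.isStopping hR.pos, ?_⟩, fun hU => ?_,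
    hM.condExp_channel hσ hN, fun t A hA => hM.condLExp_alt_eq hσ hN hA,
    fun t ω s => SJDE.condFisherInfo_eq hN _ t s⟩
  · filter_upwards [hM.cost_le_optCost (c₀ := c₀) (c₁ := c₁) (ce := ce) hσ hN hτ
      SJDE.one_le_stopAt] with ω hω hne
    obtain ⟨t, ht⟩ := hcoe hne
    exact (hω t ht).trans ((hγ _ (SJDE.U_nonneg t ω)).2 (SJDE.le_U_of_stopAt_eq ht))
  · filter_upwards [hM.optCost_le_cost (c₀ := c₀) (c₁ := c₁) (ce := ce) hσ hN hF.toIsRule,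
      hF.cost_le] with ω hω hcost
    by_cases hne : τ ω = ⊤
    · rw [hne]
      exact le_top
    obtain ⟨t, ht⟩ := hcoe hne
    -- The hitting time searches from time 1 on, so the rule's obligation to take a sample is
    -- needed: γ may already be reached by U_0 = 0.
    have hpos : 1 ≤ t := by
      have := hF.pos ω
      rw [ht] at this
      exact WithTop.coe_le_coe.1 this
    rw [ht]
    exact SJDE.stopAt_le hpos ((hγ _ (SJDE.U_nonneg t ω)).1 ((hω t ht).trans (hcost hne)))
  · filter_upwards [hM.optCost_le_cost (c₀ := c₀) (c₁ := c₁) (ce := ce) hσ hN hR,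
      hM.cost_le_optCost (c₀ := c₀) (c₁ := c₁) (ce := ce) hσ hN hR.isStopping hR.pos]
      with ω h1 h2 hne
    obtain ⟨t, ht⟩ := hcoe hne
    exact (h2 t ht).trans (h1 t ht)
  · filter_upwards [hU] with ω hω
    obtain ⟨t, ht, ht1⟩ :=
      ((hω.eventually_ge_atTop γ).and (Filter.eventually_ge_atTop 1)).exists
    exact ne_top_of_le_ne_top WithTop.coe_ne_top (SJDE.stopAt_le ht1 ht)
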